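/- Let $\mathbf k$ be a field and let $m\ge 0$, $n\ge 1$ be integers. Let $\vec A_m\otimes\vec A_n$ denote the poset $\{1<\dots<m\}\times\{1<\dots<n\}$ with the product order (regarded as a category), and let $\operatorname{rep}_{\mathbf k}(\vec A_m\otimes\vec A_n)$ be the category of functors $X=(X_{i,j})$ from it to finite-dimensional $\mathbf k$-vector spaces. Call the maps $X_{i,j}\to X_{i',j}$ ($i\le i'$) horizontal and the maps $X_{i,j}\to X_{i,j'}$ ($j\le j'$) vertical. Let $\operatorname{rep}^{\mathsf e,*}_{\mathbf k}(\vec A_m\otimes\vec A_n)$ be the full subcategory of those $X$ all of whose horizontal maps are epimorphisms, and $\operatorname{rep}^{\mathsf e,\mathsf m}_{\mathbf k}(\vec A_m\otimes\vec A_n)$ the full subcategory of those $X$ whose horizontal maps are epimorphisms and whose vertical maps are monomorphisms. For a full subcategory $\mathcal X$ of an additive category $\mathcal E$ that contains $0$ and is closed under finite direct sums, $\mathcal E/\mathcal X$ denotes the additive quotient: it has the objects of $\mathcal E$, and its morphisms are those of $\mathcal E$ modulo the relation $f\sim g$ if and only if $f-g$ factors through an object of $\mathcal X$. (1) The functor $\mathsf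 t\colon \operatorname{rep}^{\mathsf e,*}_{\mathbf k}(\vec A_m\otimes\vec A_n)\to\operatorname{rep}_{\mathbf k}(\vec A_m\otimes\vec A_{n-1})$ given by $$(\mathsf tX)_{i,j}=\ker\bigl(X_{i,j}\to X_{i,n}\bigr)\qquad(1\le i\le m,\ 1\le j\le n-1),$$ with the maps induced by those of $X$, identifies morphisms whose difference factors through an object of $\operatorname{rep}^{\mathsf e,\mathsf m}_{\mathbf k}(\vec A_m\otimes\vec A_n)$, and the functor it induces is an equivalence of categories $$\frac{\operatorname{rep}^{\mathsf e,*}_{\mathbf k}(\vec A_m\otimes\vec A_n)}{\operatorname{rep}^{\mathsf e,\mathsf m}_{\mathbf k}(\vec A_m\otimes\vec A_n)}\;\xrightarrow{\ \simeq\ }\;\operatorname{rep}_{\mathbf k}(\vec A_m\otimes\vec A_{n-1}).$$ (2) A representation $X\in\operatorname{rep}_{\mathbf k}(\vec A_m\otimes\vec A_n)$ lies in $\operatorname{rep}^{\mathsf e,\mathsf m}_{\mathbf k}(\vec A_m\otimes\vec A_n)$ if and only if it is isomorphic to a finite (possibly empty) direct sum of thin modules $\mathbf k_{\{1,\dots,i\}\times\{j,\dots,n\}}$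 with $1\le i\le m$ and $1\le j\le n$. Here, for a convex subset $C$ of a poset, $\mathbf k_C$ is the representation equal to $\mathbf k$ at the points of $C$ and $0$ elsewhere, whose maps between points of $C$ are identities. -/

import Mathlib

open CategoryTheory CategoryTheory.Limits

universe u

noncomputable section

section AdditiveQuotient

variable {C : Type*} [Category* C] [Preadditive C]

/-- Two parallel morphisms are related when their difference factors through an object
satisfying `P`. -/
def factorRel (P : ObjectProperty C) : HomRel C :=
  fun X Y f g => ∃ Z : C, P Z ∧ ∃ (a : X ⟶ Z) (b : Z ⟶ Y), a ≫ b = f - g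

/-- The additive quotient `C / P`: the objects are those of `C`, and the morphisms are the
morphisms of `C` modulo `factorRel P`. -/
abbrev AdditiveQuotient (P : ObjectProperty C) : Type _ :=
  CategoryTheory.Quotient (factorRel P)

/-- If the (nonempty) class `P` is closed under binary direct sums, `factorRel P` is already a
congruence, so that `AdditiveQuotient P` identifies exactly the morphisms whose difference factors
through an object satisfying `P`. -/
theorem factorRel_congruence (P : ObjectProperty C) (h₀ : ∃ Z, P Z)
    (hP : ∀ Z W : C, P Z → P W → ∃ B : BinaryBicone Z W, P B.pt) :
    Congruence (factorRel P) where
  comp_left := by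
    rintro X Y Z f g g' ⟨W, hW, a, b, h⟩
    exact ⟨W, hW, f ≫ a, b, by rw [Category.assoc, h, Preadditive.comp_sub]⟩
  comp_right := by
    rintro X Y Z f f' g ⟨W, hW, a, b, h⟩
    exact ⟨W, hW, a, b ≫ g, by rw [← Category.assoc, h, Preadditive.sub_comp]⟩
  equivalence :=
    { refl := fun f => by
        obtain ⟨Z, hZ⟩ := h₀
        exact ⟨Z, hZ, 0, 0, by simp⟩
      symm := by
        rintro f g ⟨W, hW, a, b, h⟩
        exact ⟨W, hW, -a, b, by simp [h]⟩
      trans := by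
        rintro f g l ⟨Z, hZ, a, b, h⟩ ⟨W, hW, c, d, h'⟩
        obtain ⟨B, hB⟩ := hP Z W hZ hW
        refine ⟨B.pt, hB, a ≫ B.inl + c ≫ B.inr, B.fst ≫ b + B.snd ≫ d, ?_⟩
        have e : a ≫ b + c ≫ d = f - l := by rw [h, h']; abel
        simp [← e] }

end AdditiveQuotient

/-- The poset `{1 < ⋯ < m} × {1 < ⋯ < n}` with the product order, i.e. the commutative grid
`A_m ⊗ A_n`; it is regarded as a category through its order only. -/
def Grid (m n : ℕ) : Type := Fin m × Fin n

namespace Grid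

variable {m n : ℕ}

instance : PartialOrder (Grid m n) := inferInstanceAs (PartialOrder (Fin m × Fin n))

/-- The vertex in column `i` and row `j`. -/
def pt (i : Fin m) (j : Fin n) : Grid m n := (i, j)

/-- The horizontal morphism `(i, j) ⟶ (i', j)`. -/
def horiz {i i' : Fin m} (h : i ≤ i') (j : Fin n) : pt i j ⟶ pt i' j :=
  homOfLE (Prod.mk_le_mk.2 ⟨h, le_rfl⟩)

/-- The vertical morphism `(i, j) ⟶ (i, j')`. -/
def vert (i : Fin m) {j j' : Fin n} (h : j ≤ j') : pt i j ⟶ pt i j' :=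
  homOfLE (Prod.mk_le_mk.2 ⟨le_rfl, h⟩)

/-- The inclusion of the first `n` rows of a grid with `n + 1` rows. -/
def initRows (m n : ℕ) : Grid m n ⥤ Grid m (n + 1) :=
  Monotone.functor (f := fun p : Grid m n => pt p.1 p.2.castSucc) fun _ _ h =>
    Prod.mk_le_mk.2 ⟨h.1, Fin.castSucc_le_castSucc_iff.2 h.2⟩

/-- The projection of all vertices to the last row. -/
def toLastRow (m n : ℕ) : Grid m n ⥤ Grid m (n + 1) :=
  Monotone.functor (f := fun p : Grid m n => pt p.1 (Fin.last n)) fun _ _ h =>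
    Prod.mk_le_mk.2 ⟨h.1, le_rfl⟩

/-- The vertical morphisms `(i, j) ⟶ (i, n + 1)` into the last row, for `j ≤ n`. -/
def initToLast (m n : ℕ) : initRows m n ⟶ toLastRow m n where
  app p := vert p.1 (Fin.le_last p.2.castSucc)
  naturality _ _ _ := Subsingleton.elim _ _

end Grid

variable (k : Type u) [Field k]

/-- The category of representations of the grid `A_m ⊗ A_n` in finite dimensional `k`-vector
spaces. -/
abbrev GridRep (m n : ℕ) : Type (u + 1) := Grid m n ⥤ FGModuleCat.{u} k

instance (m n : ℕ) : HasFiniteBiproducts (GridRep k m n) := Abelian.hasFiniteBiproducts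

/-- All horizontal morphisms are epimorphisms. -/
def horizEpi (m n : ℕ) : ObjectProperty (GridRep k m n) := fun X =>
  ∀ (i i' : Fin m) (h : i ≤ i') (j : Fin n), Epi (X.map (Grid.horiz h j))

/-- All vertical morphisms are monomorphisms. -/
def vertMono (m n : ℕ) : ObjectProperty (GridRep k m n) := fun X =>
  ∀ (i : Fin m) (j j' : Fin n) (h : j ≤ j'), Mono (X.map (Grid.vert i h))

/-- The objects of `rep^{e,*}(A_m ⊗ A_n)`, as a category. -/
abbrev RepEStar (m n : ℕ) : Type (u + 1) := (horizEpi k m n).FullSubcategory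

/-- The property defining `rep^{e,m}(A_m ⊗ A_n)`: horizontal morphisms are epimorphisms and
vertical morphisms are monomorphisms. -/
def horizEpiVertMono (m n : ℕ) : ObjectProperty (GridRep k m n) := fun X =>
  horizEpi k m n X ∧ vertMono k m n X

/-- `rep^{e,m}(A_m ⊗ A_n)` as a full subcategory of `rep^{e,*}(A_m ⊗ A_n)`. -/
def repEM (m n : ℕ) : ObjectProperty (RepEStar k m n) := fun X => horizEpiVertMono k m n X.obj

/-- `rep^{e,m}` contains zero and is closed under direct sums, so two morphisms of `rep^{e,*}` agree
in the quotient by `rep^{e,m}` exactly when their difference factors through `rep^{e,m}`. -/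
instance repEM_congruence (m n : ℕ) : Congruence (factorRel (repEM k m n)) := by
  apply factorRel_congruence
  · let Z : GridRep k m n := (Functor.const _).obj (FGModuleCat.of k PUnit)
    have hZ : horizEpi k m n Z := fun i i' h j =>
      inferInstanceAs (Epi (𝟙 (FGModuleCat.of k PUnit)))
    exact ⟨⟨Z, hZ⟩, hZ, fun i j j' h => inferInstanceAs (Mono (𝟙 (FGModuleCat.of k PUnit)))⟩
  · intro Z W hZ hW
    have tot : ∀ p : Grid m n,
        (biprod.fst : Z.obj ⊞ W.obj ⟶ _).app p ≫ (biprod.inl : _ ⟶ Z.obj ⊞ W.obj).app p +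
          (biprod.snd : Z.obj ⊞ W.obj ⟶ _).app p ≫ (biprod.inr : _ ⟶ Z.obj ⊞ W.obj).app p =
        𝟙 _ := fun p =>
      congrArg (fun φ => φ.app p) (biprod.total (X := Z.obj) (Y := W.obj))
    have hE : horizEpi k m n (Z.obj ⊞ W.obj) := by
      intro i i' h j
      have h₁ := hZ.1 i i' h j
      have h₂ := hW.1 i i' h j
      refine ⟨fun u v huv => ?_⟩
      have e₁ : (biprod.inl : _ ⟶ Z.obj ⊞ W.obj).app _ ≫ u =
          (biprod.inl : _ ⟶ Z.obj ⊞ W.obj).app _ ≫ v := by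
        rw [← cancel_epi (Z.obj.map (Grid.horiz h j)), NatTrans.naturality_assoc,
          NatTrans.naturality_assoc, huv]
      have e₂ : (biprod.inr : _ ⟶ Z.obj ⊞ W.obj).app _ ≫ u =
          (biprod.inr : _ ⟶ Z.obj ⊞ W.obj).app _ ≫ v := by
        rw [← cancel_epi (W.obj.map (Grid.horiz h j)), NatTrans.naturality_assoc,
          NatTrans.naturality_assoc, huv]
      rw [← Category.id_comp u, ← Category.id_comp v, ← tot, Preadditive.add_comp,
        Preadditive.add_comp, Category.assoc, Category.assoc, Category.assoc, Category.assoc,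
        e₁, e₂]
    have hM : vertMono k m n (Z.obj ⊞ W.obj) := by
      intro i j j' h
      have h₁ := hZ.2 i j j' h
      have h₂ := hW.2 i j j' h
      refine ⟨fun u v huv => ?_⟩
      have e₁ : u ≫ (biprod.fst : Z.obj ⊞ W.obj ⟶ _).app _ =
          v ≫ (biprod.fst : Z.obj ⊞ W.obj ⟶ _).app _ := by
        rw [← cancel_mono (Z.obj.map (Grid.vert i h)), Category.assoc, Category.assoc,
          ← NatTrans.naturality, reassoc_of% huv]
      have e₂ : u ≫ (biprod.snd : Z.obj ⊞ W.obj ⟶ _).app _ =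
          v ≫ (biprod.snd : Z.obj ⊞ W.obj ⟶ _).app _ := by
        rw [← cancel_mono (W.obj.map (Grid.vert i h)), Category.assoc, Category.assoc,
          ← NatTrans.naturality, reassoc_of% huv]
      rw [← Category.comp_id u, ← Category.comp_id v, ← tot, Preadditive.comp_add,
        Preadditive.comp_add, reassoc_of% e₁, reassoc_of% e₂]
    refine ⟨{ pt := ⟨Z.obj ⊞ W.obj, hE⟩
              fst := ObjectProperty.homMk biprod.fst
              snd := ObjectProperty.homMk biprod.snd
              inl := ObjectProperty.homMk biprod.inl
              inr := ObjectProperty.homMk biprod.inr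
              inl_fst := ?_
              inl_snd := ?_
              inr_fst := ?_
              inr_snd := ?_ }, hE, hM⟩ <;>
      apply ObjectProperty.hom_ext <;> simp

variable {k} in
/-- For a morphism `φ : X ⟶ Y` of diagrams of finite dimensional vector spaces, the diagram of
the kernels of its components. -/
def kernelDiagram {J : Type*} [Category* J] {X Y : J ⥤ FGModuleCat.{u} k} (φ : X ⟶ Y) :
    J ⥤ FGModuleCat.{u} k where
  obj p := FGModuleCat.of k (LinearMap.ker (φ.app p).hom.hom)
  map {p q} f := FGModuleCat.ofHom ((X.map f).hom.hom.restrict fun x hx => by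
    have h := LinearMap.congr_fun (congrArg (fun g => g.hom.hom) (φ.naturality f)) x
    simp only [FGModuleCat.hom_hom_comp, LinearMap.comp_apply] at h
    rw [LinearMap.mem_ker] at hx ⊢
    rw [hx, map_zero] at h
    exact h)
  map_id p := by
    ext x
    change (X.map (𝟙 p)).hom.hom x.1 = x.1
    rw [X.map_id]
    rfl
  map_comp f g := by
    ext x
    change (X.map (f ≫ g)).hom.hom x.1 = (X.map g).hom.hom ((X.map f).hom.hom x.1)
    rw [X.map_comp]
    rfl

/-- The kernel functor `t`, given on objects by `(t X)_{i,j} = ker (X_{i,j} ⟶ X_{i,n+1})` for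
`j ≤ n`, with the maps induced by those of `X`. -/
def kernelFunctor (m n : ℕ) : GridRep k m (n + 1) ⥤ GridRep k m n where
  obj X := kernelDiagram (Functor.whiskerRight (Grid.initToLast m n) X)
  map {X Y} f :=
    { app p := FGModuleCat.ofHom ((f.app ((Grid.initRows m n).obj p)).hom.hom.restrict
        fun x hx => by
          have h := LinearMap.congr_fun (congrArg (fun g => g.hom.hom)
            (f.naturality ((Grid.initToLast m n).app p))) x
          simp only [FGModuleCat.hom_hom_comp, LinearMap.comp_apply] at h
          rw [LinearMap.mem_ker] at hx ⊢
          simp only [Functor.whiskerRight_app] at hx ⊢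
          rw [hx, map_zero] at h
          exact h.symm)
      naturality p q g := by
        ext x
        apply Subtype.ext
        exact LinearMap.congr_fun (congrArg (fun g => g.hom.hom)
          (f.naturality ((Grid.initRows m n).map g))) x.1 }
  map_id X := by
    ext p x
    rfl
  map_comp f g := by
    ext p x
    rfl

/-- The kernel functor on `rep^{e,*}(A_m ⊗ A_{n+1})`. -/
def tFunctor (m n : ℕ) : RepEStar k m (n + 1) ⥤ GridRep k m n :=
  (horizEpi k m (n + 1)).ι ⋙ kernelFunctor k m n

section Constant

variable {P : Type*} [PartialOrder P]

open Classical in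
/-- The vector space `k` at the points of `S`, and `0` elsewhere. -/
def constSpace (S : Set P) (x : P) : Submodule k k := if x ∈ S then ⊤ else ⊥

open Classical in
/-- The constant representation `k_S` of a convex subset `S` of a poset: it is `k` on `S` and `0`
elsewhere, and its maps are identities between points of `S`, and zero otherwise. -/
def constRep (S : Set P) (hS : S.OrdConnected) : P ⥤ FGModuleCat.{u} k where
  obj x := FGModuleCat.of k (constSpace k S x)
  map {x y} _ := FGModuleCat.ofHom
    ((if y ∈ S then LinearMap.id else 0 : k →ₗ[k] k).restrict fun a _ => by
      by_cases hy : y ∈ S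
      · rw [constSpace, if_pos hy]
        exact Submodule.mem_top
      · rw [if_neg hy]
        exact Submodule.zero_mem _)
  map_id x := by
    ext a
    obtain ⟨a, ha⟩ := a
    change (if x ∈ S then LinearMap.id else 0 : k →ₗ[k] k) a = a
    by_cases hx : x ∈ S
    · simp [hx]
    · have h0 : a = 0 := by
        rw [constSpace, if_neg hx] at ha
        exact (Submodule.mem_bot k).1 ha
      simp [h0]
  map_comp {x y z} f g := by
    ext a
    obtain ⟨a, ha⟩ := a
    change (if z ∈ S then LinearMap.id else 0 : k →ₗ[k] k) a =
      (if z ∈ S then LinearMap.id else 0 : k →ₗ[k] k)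
        ((if y ∈ S then LinearMap.id else 0 : k →ₗ[k] k) a)
    by_cases hx : x ∈ S
    · by_cases hz : z ∈ S
      · have hy : y ∈ S := hS.out hx hz ⟨leOfHom f, leOfHom g⟩
        simp [hy, hz]
      · simp [hz]
    · have h0 : a = 0 := by
        rw [constSpace, if_neg hx] at ha
        exact (Submodule.mem_bot k).1 ha
      simp [h0]

end Constant

/-- The rectangle `{1, …, i} × {j, …, n}` in the grid. -/
def Grid.corner {m n : ℕ} (i : Fin m) (j : Fin n) : Set (Grid m n) :=
  {p | p.1 ≤ i ∧ j ≤ p.2}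

theorem Grid.corner_ordConnected {m n : ℕ} (i : Fin m) (j : Fin n) :
    (Grid.corner i j).OrdConnected :=
  ⟨fun _ hp _ hq _ hr => ⟨hr.2.1.trans hq.1, hp.2.trans hr.1.2⟩⟩

/-- The thin module `k_{{1, …, i} × {j, …, n}}`. -/
def thinRect {m n : ℕ} (i : Fin m) (j : Fin n) : GridRep k m n :=
  constRep k (Grid.corner i j) (Grid.corner_ordConnected i j)

end

/-!
# Kernels of vertical maps and monomorphic representations of commutative grids

A representation in `rep^{e,m}` is determined by two chains of subspaces of its space `V` in the
position of the first column and last row: the images of the spaces of the first column, and the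
kernels of the maps along the last row.  Two chains of subspaces always have a common adapted basis
(`exists_adapted_basis`), and each vector of such a basis spans a thin module
(`exists_iso_thinRect`).  Conversely, thin modules lie in `rep^{e,m}`, which is closed under direct
sums.

For the equivalence, let `X` be in `rep^{e,*}` and let `X'` be the image of the morphism from `X` to
its last row, repeated in all rows.  It lies in `rep^{e,m}`, and the kernel of `X ⟶ X'` is `t X`,
extended by zero to the last row.  This gives the three properties of the induced functor.

* Faithful: a morphism out of `X` that vanishes on `t X` factors through `X'` (`factorRel_iff`).
* Full: a morphism `t X ⟶ t Y` extends to `X ⟶ Y` because `Ext¹(X', Y) = 0`.  Indeed `X'` is a sum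
  of thin modules, each of which has a projective resolution with one generator, in the first
  column, and at most one relation, in the same row; it can be lifted along the horizontal
  epimorphisms of `Y` (`exists_extension`).
* Essentially surjective: given `Z`, embed its row `j` into the representation with
  `E i = ∏_{a ≥ i} Z (a, j)`.  Its image is the kernel of the map to `G i = ∏_{i ≤ a ≤ b} Z (b, j)`
  that measures the failure of a family to be compatible with the horizontal maps, and the
  horizontal maps of `E` and `G` are projections.  Retaining the entries in the `G`'s of all earlier
  rows yields a representation in `rep^{e,*}` whose diagram of kernels is `Z` (`horizHull`,
  `isIso_toKernelHull`).
-/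

noncomputable section

/-! ### Bases adapted to two chains of subspaces -/

/-- Any two chains of subspaces admit a common adapted basis: a set `B` spanning `W` freely such
that every member `U` of either chain satisfies `span (B ∩ U) = W ⊓ U`.  The induction removes a
hyperplane `H` of `W` containing all proper traces `W ⊓ U` of the first chain, and completes a
basis of `H` by a vector of the smallest member of the second chain not contained in `H`. -/
theorem exists_adapted_basis {k V : Type*} [Field k] [AddCommGroup V] [Module k V]
    [FiniteDimensional k V] {c₁ c₂ : Set (Submodule k V)} (h₁ : IsChain (· ≤ ·) c₁)
    (h₂ : IsChain (· ≤ ·) c₂) (W : Submodule k V) :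
    ∃ B : Set V, LinearIndepOn k id B ∧ Submodule.span k B = W ∧
      ∀ U ∈ c₁ ∪ c₂, Submodule.span k (B ∩ U) = W ⊓ U := by
  induction W using WellFoundedLT.induction with
  | ind W ih =>
  rcases eq_or_ne W ⊥ with rfl | hW
  · exact ⟨∅, linearIndepOn_empty k id, by simp, by simp⟩
  obtain ⟨M, hMW, hM⟩ : ∃ M < W, ∀ U ∈ c₁, ¬ W ≤ U → W ⊓ U ≤ M := by
    by_cases hne : ∃ U ∈ c₁, ¬ W ≤ U
    · obtain ⟨M, ⟨hM, hMW⟩, hmax⟩ := WellFounded.has_min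
        (wellFounded_gt (α := Submodule k V)) {U | U ∈ c₁ ∧ ¬ W ≤ U} hne
      refine ⟨W ⊓ M, inf_lt_left.2 hMW, fun U hU hWU => ?_⟩
      rcases h₁.total hU hM with h | h
      · exact inf_le_inf_left W h
      · rw [h.eq_of_not_lt (hmax U ⟨hU, hWU⟩)]
    · push Not at hne
      exact ⟨⊥, bot_lt_iff_ne_bot.2 hW, fun U hU h => absurd (hne U hU) h⟩
  obtain ⟨H, hMH, hH⟩ := exists_le_covBy_of_lt hMW
  obtain ⟨b, hbW, hbH, hb⟩ : ∃ b ∈ W, b ∉ H ∧ ∀ K ∈ c₂, ¬ W ⊓ K ≤ H → b ∈ K := by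
    by_cases hne : ∃ K ∈ c₂, ¬ W ⊓ K ≤ H
    · obtain ⟨K, ⟨hK, hKH⟩, hmin⟩ := WellFounded.has_min
        (wellFounded_lt (α := Submodule k V)) {K | K ∈ c₂ ∧ ¬ W ⊓ K ≤ H} hne
      obtain ⟨b, hb, hbH⟩ := SetLike.not_le_iff_exists.1 hKH
      refine ⟨b, hb.1, hbH, fun K' hK' hKH' => ?_⟩
      rcases h₂.total hK hK' with h | h
      · exact h hb.2
      · rw [h.eq_of_not_lt (hmin K' ⟨hK', hKH'⟩)]
        exact hb.2
    · push Not at hne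
      obtain ⟨b, hb, hbH⟩ := SetLike.not_le_iff_exists.1 hH.lt.not_ge
      exact ⟨b, hb, hbH, fun K hK h => absurd (hne K hK) h⟩
  obtain ⟨B, hBli, hBH, hB⟩ := ih H hH.lt
  have hsup : Submodule.span k {b} ⊔ H = W := by
    rcases hH.eq_or_eq (c := Submodule.span k {b} ⊔ H) le_sup_right
      (sup_le ((Submodule.span_singleton_le_iff_mem b W).2 hbW) hH.le) with h | h
    · exact absurd (h ▸ Submodule.mem_sup_left (Submodule.mem_span_singleton_self b)) hbH
    · exact h
  have hspan : Submodule.span k (insert b B) = W := by rw [Submodule.span_insert, hBH, hsup]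
  have hsmall : ∀ U ∈ c₁ ∪ c₂, W ⊓ U ≤ H → Submodule.span k (insert b B ∩ U) = W ⊓ U := by
    intro U hU hUH
    have hbU : b ∉ U := fun h => hbH (hUH ⟨hbW, h⟩)
    rw [Set.insert_inter_of_notMem hbU, hB U hU]
    exact le_antisymm (inf_le_inf_right U hH.le) (le_inf hUH inf_le_right)
  refine ⟨insert b B, ?_, hspan, fun U hU => ?_⟩
  · exact hBli.id_insert (by rwa [hBH])
  · by_cases hUH : W ⊓ U ≤ H
    · exact hsmall U hU hUH
    rcases hU with hU | hU
    · have hWU : W ≤ U := by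
        by_contra h
        exact hUH ((hM U hU h).trans hMH)
      have hsub : insert b B ⊆ (U : Set V) := fun x hx =>
        hWU (hspan ▸ Submodule.subset_span hx)
      rw [Set.inter_eq_left.2 hsub, hspan, inf_eq_left.2 hWU]
    · have hbU : b ∈ U := hb U hU hUH
      rw [Set.insert_inter_of_mem hbU, Submodule.span_insert, hB U (Or.inr hU), ← hsup,
        sup_inf_assoc_of_le H ((Submodule.span_singleton_le_iff_mem b U).2 hbU)]

/-- A basis adapted to two chains of subspaces: a vector of a member `U` of either chain only
involves those basis vectors that lie in `U`. -/
theorem exists_basis_adapted {k V : Type*} [Field k] [AddCommGroup V] [Module k V]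
    [FiniteDimensional k V] {c₁ c₂ : Set (Submodule k V)} (h₁ : IsChain (· ≤ ·) c₁)
    (h₂ : IsChain (· ≤ ·) c₂) :
    ∃ (r : ℕ) (b : Module.Basis (Fin r) k V),
      ∀ U ∈ c₁ ∪ c₂, ∀ v ∈ U, ∀ s, b s ∉ U → b.repr v s = 0 := by
  obtain ⟨B, hli, hspan, hB⟩ := exists_adapted_basis h₁ h₂ ⊤
  have hfin : Finite B := hli.setFinite
  let b₀ : Module.Basis B k V := Module.Basis.mk (v := fun x : B => (x : V)) hli
    (by rw [Subtype.range_coe, hspan])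
  have hb₀ : ∀ x : B, b₀ x = x := fun x => Module.Basis.mk_apply _ _ x
  let e := Finite.equivFin B
  refine ⟨_, b₀.reindex e, fun U hU v hv s hs => ?_⟩
  rw [Module.Basis.reindex_apply, hb₀] at hs
  rw [Module.Basis.repr_reindex_apply]
  have hle : U ≤ LinearMap.ker (b₀.coord (e.symm s)) := by
    rw [← top_inf_eq U, ← hB U hU, Submodule.span_le]
    rintro x ⟨hxB, hxU⟩
    have hx : b₀ ⟨x, hxB⟩ = x := hb₀ _
    have hne : (⟨x, hxB⟩ : B) ≠ e.symm s := by
      rintro h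
      rw [← h] at hs
      exact hs hxU
    rw [SetLike.mem_coe, LinearMap.mem_ker, Module.Basis.coord_apply, ← hx,
      Module.Basis.repr_self, Finsupp.single_eq_of_ne' hne]
  exact hle hv

/-! ### Representations of posets, elementwise -/

section Poset

variable {k : Type u} [Field k] {P : Type*} [PartialOrder P]

/-- The linear map `X p → X q` of a representation of a poset, for `p ≤ q`. -/
def tr (X : P ⥤ FGModuleCat.{u} k) {p q : P} (h : p ≤ q) : X.obj p →ₗ[k] X.obj q :=
  (X.map (homOfLE h)).hom.hom

/-- The component at `p` of a morphism of representations, as a linear map. -/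
def compAt {X Y : P ⥤ FGModuleCat.{u} k} (f : X ⟶ Y) (p : P) : X.obj p →ₗ[k] Y.obj p :=
  (f.app p).hom.hom

variable {X Y Z : P ⥤ FGModuleCat.{u} k}

theorem tr_self {p : P} (x : X.obj p) : tr X le_rfl x = x :=
  LinearMap.congr_fun (congrArg (fun g => g.hom.hom) (X.map_id p)) x

@[simp]
theorem tr_tr {p q r : P} (h : p ≤ q) (h' : q ≤ r) (x : X.obj p) :
    tr X h' (tr X h x) = tr X (h.trans h') x :=
  (LinearMap.congr_fun (congrArg (fun g => g.hom.hom)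
    (X.map_comp (homOfLE h) (homOfLE h'))) x).symm

theorem compAt_tr (f : X ⟶ Y) {p q : P} (h : p ≤ q) (x : X.obj p) :
    compAt f q (tr X h x) = tr Y h (compAt f p x) :=
  LinearMap.congr_fun (congrArg (fun g => g.hom.hom) (f.naturality (homOfLE h))) x

@[simp]
theorem compAt_comp (f : X ⟶ Y) (g : Y ⟶ Z) (p : P) (x : X.obj p) :
    compAt (f ≫ g) p x = compAt g p (compAt f p x) := rfl

@[simp]
theorem compAt_id (p : P) (x : X.obj p) : compAt (𝟙 X) p x = x := rfl

theorem compAt_sum {ι : Type*} (s : Finset ι) (f : ι → (X ⟶ Y)) (p : P) (x : X.obj p) :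
    compAt (∑ i ∈ s, f i) p x = ∑ i ∈ s, compAt (f i) p x := by
  classical
  induction s using Finset.induction_on with
  | empty => rfl
  | insert a s ha ih =>
    rw [Finset.sum_insert ha, Finset.sum_insert ha, ← ih]
    rfl

theorem hom_ext_of_compAt {f g : X ⟶ Y} (h : ∀ p x, compAt f p x = compAt g p x) : f = g := by
  ext p x
  exact h p x

/-- A morphism of representations from its linear components. -/
def mkHom (f : ∀ p, X.obj p →ₗ[k] Y.obj p)
    (h : ∀ (p q : P) (h : p ≤ q) (x : X.obj p), f q (tr X h x) = tr Y h (f p x)) : X ⟶ Y where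
  app p := FGModuleCat.ofHom (f p)
  naturality p q g := by
    ext x
    exact h p q (leOfHom g) x

@[simp]
theorem compAt_mkHom (f : ∀ p, X.obj p →ₗ[k] Y.obj p) (h) (p : P) (x : X.obj p) :
    compAt (mkHom f h) p x = f p x := rfl

/-- A representation from vector spaces and linear maps. -/
def mkRep (V : P → Type u) [∀ p, AddCommGroup (V p)] [∀ p, Module k (V p)]
    [∀ p, Module.Finite k (V p)] (T : ∀ {p q : P}, p ≤ q → V p →ₗ[k] V q)
    (hid : ∀ p x, T (le_refl p) x = x)
    (hcomp : ∀ (p q r : P) (h : p ≤ q) (h' : q ≤ r) (x : V p),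
      T h' (T h x) = T (h.trans h') x) : P ⥤ FGModuleCat.{u} k where
  obj p := FGModuleCat.of k (V p)
  map g := FGModuleCat.ofHom (T (leOfHom g))
  map_id p := by
    ext x
    exact hid p x
  map_comp g g' := by
    ext x
    exact (hcomp _ _ _ (leOfHom g) (leOfHom g') x).symm

end Poset

section EpiMono

variable {k : Type u} [Field k] {V W : FGModuleCat.{u} k} (f : V ⟶ W)

theorem fg_epi_iff_surjective : Epi f ↔ Function.Surjective f.hom.hom := by
  constructor
  · intro h
    have : Epi ((forget₂ (FGModuleCat k) (ModuleCat.{u} k)).map f) := inferInstance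
    exact (ModuleCat.epi_iff_surjective _).1 this
  · intro h
    have : Epi ((forget₂ (FGModuleCat k) (ModuleCat.{u} k)).map f) :=
      (ModuleCat.epi_iff_surjective _).2 h
    exact Functor.epi_of_epi_map (forget₂ (FGModuleCat k) (ModuleCat.{u} k)) this

theorem fg_mono_iff_injective : Mono f ↔ Function.Injective f.hom.hom := by
  constructor
  · intro h
    have : Mono ((forget₂ (FGModuleCat k) (ModuleCat.{u} k)).map f) := inferInstance
    exact (ModuleCat.mono_iff_injective _).1 this
  · intro h
    have : Mono ((forget₂ (FGModuleCat k) (ModuleCat.{u} k)).map f) :=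
      (ModuleCat.mono_iff_injective _).2 h
    exact Functor.mono_of_mono_map (forget₂ (FGModuleCat k) (ModuleCat.{u} k)) this

end EpiMono

section Grid

variable {k : Type u} [Field k] {m n : ℕ} {X : GridRep k m n}

theorem Grid.pt_le_pt {i i' : Fin m} {j j' : Fin n} :
    Grid.pt i j ≤ Grid.pt i' j' ↔ i ≤ i' ∧ j ≤ j' := Iff.rfl

theorem horizEpi_iff : horizEpi k m n X ↔
    ∀ (i i' : Fin m) (j : Fin n) (h : Grid.pt i j ≤ Grid.pt i' j),
      Function.Surjective (tr X h) :=
  ⟨fun H i i' j h => (fg_epi_iff_surjective _).1 (H i i' h.1 j),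
    fun H i i' h j => (fg_epi_iff_surjective _).2 (H i i' j ⟨h, le_rfl⟩)⟩

theorem vertMono_iff : vertMono k m n X ↔
    ∀ (i : Fin m) (j j' : Fin n) (h : Grid.pt i j ≤ Grid.pt i j'),
      Function.Injective (tr X h) :=
  ⟨fun H i j j' h => (fg_mono_iff_injective _).1 (H i j j' h.2),
    fun H i j j' h => (fg_mono_iff_injective _).2 (H i j j' ⟨le_rfl, h⟩)⟩

end Grid

/-! ### Maps into and out of the thin modules -/

section Thin

variable {k : Type u} [Field k] {m n : ℕ} {X Y : GridRep k m n}

theorem thinRect_eq_zero {i : Fin m} {j : Fin n} {p : Grid m n} (hp : p ∉ Grid.corner i j)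
    (a : (thinRect k i j).obj p) : a.1 = 0 := by
  exact (Submodule.mem_bot k).1 ((if_neg hp : constSpace k (Grid.corner i j) p = ⊥).le a.2)

theorem thinRect_mem {i : Fin m} {j : Fin n} {p : Grid m n} (hp : p ∈ Grid.corner i j) (a : k) :
    a ∈ constSpace k (Grid.corner i j) p := by
  rw [constSpace, if_pos hp]
  exact Submodule.mem_top

theorem tr_thinRect_of_mem {i : Fin m} {j : Fin n} {p q : Grid m n} (h : p ≤ q)
    (hq : q ∈ Grid.corner i j) (a : (thinRect k i j).obj p) :
    (tr (thinRect k i j) h a).1 = a.1 := by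
  classical
  change (if q ∈ Grid.corner i j then LinearMap.id else 0 : k →ₗ[k] k) a.1 = a.1
  rw [if_pos hq]
  rfl

/-- A compatible system of linear forms on `X`, vanishing outside the rectangle, as a morphism
from `X` to the thin module. -/
def toThin (i : Fin m) (j : Fin n) (γ : ∀ p, X.obj p →ₗ[k] k)
    (h₀ : ∀ p, p ∉ Grid.corner i j → γ p = 0)
    (h : ∀ (p q : Grid m n) (h : p ≤ q) (x : X.obj p), q ∈ Grid.corner i j →
      γ q (tr X h x) = γ p x) : X ⟶ thinRect k i j :=
  mkHom (fun p => (γ p).codRestrict (constSpace k (Grid.corner i j) p) fun x => by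
      by_cases hp : p ∈ Grid.corner i j
      · exact thinRect_mem hp _
      · rw [h₀ p hp]
        exact Submodule.zero_mem _) fun p q hpq x => by
    apply Subtype.ext
    by_cases hq : q ∈ Grid.corner i j
    · rw [tr_thinRect_of_mem hpq hq]
      exact h p q hpq x hq
    · rw [thinRect_eq_zero hq, thinRect_eq_zero hq]

variable [NeZero m]

/-- The images of a vector `x` in the first column of row `j`, extended by zero below that row. -/
def extVec (X : GridRep k m n) {j : Fin n} (x : X.obj (Grid.pt 0 j)) (p : Grid m n) : X.obj p :=
  if h : j ≤ p.2 then tr X (⟨Fin.zero_le _, h⟩ : Grid.pt 0 j ≤ p) x else 0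

theorem extVec_of_le {j : Fin n} (x : X.obj (Grid.pt 0 j)) {p : Grid m n} (h : Grid.pt 0 j ≤ p) :
    extVec X x p = tr X h x := dif_pos h.2

theorem tr_extVec {j : Fin n} (x : X.obj (Grid.pt 0 j)) {p q : Grid m n} (h : j ≤ p.2)
    (hpq : p ≤ q) : tr X hpq (extVec X x p) = extVec X x q := by
  have hp : Grid.pt 0 j ≤ p := ⟨Fin.zero_le _, h⟩
  rw [extVec_of_le x hp, extVec_of_le x (hp.trans hpq), tr_tr]

theorem compAt_extVec (f : X ⟶ Y) {j : Fin n} (x : X.obj (Grid.pt 0 j)) (p : Grid m n) :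
    compAt f p (extVec X x p) = extVec Y (compAt f _ x) p := by
  unfold extVec
  split_ifs
  · exact compAt_tr f _ x
  · exact map_zero _

theorem extVec_eq_zero {i : Fin m} {j : Fin n} {x : X.obj (Grid.pt 0 j)}
    (hx : ∀ (q : Grid m n) (h : Grid.pt 0 j ≤ q), ¬ q.1 ≤ i → tr X h x = 0) {p : Grid m n}
    (hp : p ∉ Grid.corner i j) : extVec X x p = 0 := by
  by_cases h : j ≤ p.2
  · have h' : Grid.pt 0 j ≤ p := ⟨Fin.zero_le _, h⟩
    rw [extVec_of_le x h']
    exact hx p h' fun hi => hp ⟨hi, h⟩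
  · exact dif_neg h

/-- The thin module of the rectangle `{1, …, i} × {j, …, n}` is generated by a vector in position
`(1, j)`, subject to the relation that this vector dies to the right of column `i`. -/
def ofThin (i : Fin m) {j : Fin n} (x : X.obj (Grid.pt 0 j))
    (hx : ∀ (q : Grid m n) (h : Grid.pt 0 j ≤ q), ¬ q.1 ≤ i → tr X h x = 0) :
    thinRect k i j ⟶ X :=
  mkHom (fun p => (LinearMap.toSpanSingleton k _ (extVec X x p)).comp
      (constSpace k (Grid.corner i j) p).subtype) fun p q hpq a => by
    change (tr (thinRect k i j) hpq a).1 • extVec X x q = tr X hpq (a.1 • extVec X x p)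
    by_cases hp : p ∈ Grid.corner i j
    · rw [map_smul, tr_extVec x hp.2]
      by_cases hq : q ∈ Grid.corner i j
      · rw [tr_thinRect_of_mem hpq hq]
      · rw [extVec_eq_zero hx hq, smul_zero, smul_zero]
    · have ha : a = 0 := Subtype.ext (thinRect_eq_zero hp a)
      rw [ha, map_zero]
      change (0 : k) • extVec X x q = tr X hpq ((0 : k) • extVec X x p)
      rw [zero_smul, zero_smul, map_zero]

end Thin

/-! ### Representations with epic horizontal and monic vertical maps -/

section Decomposition

variable {k : Type u} [Field k] {m n : ℕ}

theorem horizEpiVertMono_thinRect (i : Fin m) (j : Fin n) :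
    horizEpiVertMono k m n (thinRect k i j) := by
  refine ⟨horizEpi_iff.2 fun a a' l h y => ?_, vertMono_iff.2 fun a l l' h x y hxy => ?_⟩
  · by_cases hq : Grid.pt a' l ∈ Grid.corner i j
    · exact ⟨⟨y.1, thinRect_mem (p := Grid.pt a l) ⟨h.1.trans hq.1, hq.2⟩ _⟩,
        Subtype.ext (tr_thinRect_of_mem h hq _)⟩
    · exact ⟨0, Subtype.ext (by rw [map_zero, thinRect_eq_zero hq y]; rfl)⟩
  · apply Subtype.ext
    by_cases hp : Grid.pt a l ∈ Grid.corner i j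
    · have hq : Grid.pt a l' ∈ Grid.corner i j := ⟨hp.1, hp.2.trans h.2⟩
      rw [← tr_thinRect_of_mem h hq x, hxy, tr_thinRect_of_mem h hq y]
    · rw [thinRect_eq_zero hp x, thinRect_eq_zero hp y]

/-- The class `rep^{e,m}` is closed under direct sums and direct summands. -/
theorem horizEpiVertMono_of_sum {ι : Type*} [Fintype ι] {X : GridRep k m n}
    {F : ι → GridRep k m n} (hF : ∀ s, horizEpiVertMono k m n (F s)) (π : ∀ s, X ⟶ F s)
    (σ : ∀ s, F s ⟶ X) (h : ∑ s, π s ≫ σ s = 𝟙 X) : horizEpiVertMono k m n X := by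
  have hsum : ∀ (p : Grid m n) (x : X.obj p), ∑ s, compAt (σ s) p (compAt (π s) p x) = x := by
    intro p x
    conv_rhs => rw [← compAt_id p x, ← h, compAt_sum]
    rfl
  refine ⟨horizEpi_iff.2 fun i i' j hle y => ?_, vertMono_iff.2 fun i j j' hle => ?_⟩
  · choose z hz using fun s => horizEpi_iff.1 (hF s).1 i i' j hle (compAt (π s) _ y)
    refine ⟨∑ s, compAt (σ s) _ (z s), ?_⟩
    rw [map_sum]
    simp_rw [← compAt_tr, hz]
    exact hsum _ y
  · rw [injective_iff_map_eq_zero]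
    intro x hx
    rw [← hsum _ x]
    refine Finset.sum_eq_zero fun s _ => ?_
    have h0 : compAt (π s) _ x = 0 := by
      apply vertMono_iff.1 (hF s).2 i j j' hle
      rw [← compAt_tr, hx, map_zero, map_zero]
    rw [h0, map_zero]

/-- An isomorphism to a finite direct sum, in terms of projections and inclusions. -/
theorem exists_sum_eq_id_of_iso {r : ℕ} {X : GridRep k m n} {F : Fin r → GridRep k m n}
    (e : X ≅ ⨁ F) :
    ∃ (π : ∀ s, X ⟶ F s) (σ : ∀ s, F s ⟶ X), ∑ s, π s ≫ σ s = 𝟙 X := by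
  refine ⟨fun s => e.hom ≫ biproduct.π F s, fun s => biproduct.ι F s ≫ e.inv, ?_⟩
  have h := e.hom_inv_id
  rw [← Category.id_comp e.inv, ← biproduct.total (f := F)] at h
  simpa only [Preadditive.comp_sum, Preadditive.sum_comp, Category.assoc] using h

theorem Fin.exists_le_iff_of_antitone [NeZero m] {p : Fin m → Prop}
    (hp : ∀ i i', i ≤ i' → p i' → p i) (h₀ : p 0) : ∃ i, ∀ i', i' ≤ i ↔ p i' := by
  classical
  have hne : (Finset.univ.filter p).Nonempty := ⟨0, by simpa using h₀⟩
  refine ⟨(Finset.univ.filter p).max' hne, fun i' => ⟨fun h => hp _ _ h ?_, fun h => ?_⟩⟩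
  · simpa using Finset.max'_mem _ hne
  · exact Finset.le_max' _ _ (by simpa using h)

theorem Fin.exists_le_iff_of_monotone {p : Fin (n + 1) → Prop}
    (hp : ∀ j j', j ≤ j' → p j → p j') (h₀ : p (Fin.last n)) : ∃ j, ∀ j', j ≤ j' ↔ p j' := by
  classical
  have hne : (Finset.univ.filter p).Nonempty := ⟨Fin.last n, by simpa using h₀⟩
  refine ⟨(Finset.univ.filter p).min' hne, fun j' => ⟨fun h => hp _ _ h ?_, fun h => ?_⟩⟩
  · simpa using Finset.min'_mem _ hne
  · exact Finset.min'_le _ _ (by simpa using h)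

/-- A representation with epic horizontal and monic vertical maps is determined by two chains of
subspaces of the space `V` in position `(1, n)`: the images `U j` of the spaces in the first
column, and the kernels `K i` of the maps along the last row.  A basis of `V` adapted to both
chains splits the representation into thin modules. -/
theorem exists_iso_thinRect_of_neZero [NeZero m] {X : GridRep k m (n + 1)}
    (hX : horizEpiVertMono k m (n + 1) X) :
    ∃ (r : ℕ) (i : Fin r → Fin m) (j : Fin r → Fin (n + 1)),
      Nonempty (X ≅ ⨁ fun s : Fin r => thinRect k (i s) (j s)) := by
  classical
  have hE := horizEpi_iff.1 hX.1
  have hM := vertMono_iff.1 hX.2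
  have hz : ∀ i : Fin m, (0 : Fin m) ≤ i := fun i => Fin.zero_le i
  have hl : ∀ j : Fin (n + 1), j ≤ Fin.last n := Fin.le_last
  let V := X.obj (Grid.pt 0 (Fin.last n))
  -- the map from the first column to `V`, and the map from `V` to the last row
  let u (j : Fin (n + 1)) : X.obj (Grid.pt 0 j) →ₗ[k] V :=
    tr X (Grid.pt_le_pt.2 ⟨le_rfl, hl j⟩)
  let v (i : Fin m) : V →ₗ[k] X.obj (Grid.pt i (Fin.last n)) :=
    tr X (Grid.pt_le_pt.2 ⟨hz i, le_rfl⟩)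
  let U (j : Fin (n + 1)) : Submodule k V := LinearMap.range (u j)
  let K (i : Fin m) : Submodule k V := LinearMap.ker (v i)
  have hU : Monotone U := by
    rintro j j' h _ ⟨x, rfl⟩
    exact ⟨tr X (Grid.pt_le_pt.2 ⟨le_rfl, h⟩) x, tr_tr _ _ _⟩
  have hK : Monotone K := by
    intro i i' h x hx
    have hx' : v i x = 0 := hx
    have e : v i' x = tr X (Grid.pt_le_pt.2 ⟨h, le_rfl⟩) (v i x) := (tr_tr _ _ _).symm
    change v i' x = 0
    rw [e, hx', map_zero]
  obtain ⟨r, b, hb⟩ := exists_basis_adapted hU.isChain_range hK.isChain_range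
  have hbU : ∀ j, ∀ x ∈ U j, ∀ s, b s ∉ U j → b.repr x s = 0 := fun j =>
    hb (U j) (Or.inl ⟨j, rfl⟩)
  have hbK : ∀ i, ∀ x ∈ K i, ∀ s, b s ∉ K i → b.repr x s = 0 := fun i =>
    hb (K i) (Or.inr ⟨i, rfl⟩)
  choose i hi using fun s : Fin r => Fin.exists_le_iff_of_antitone (p := fun i => b s ∉ K i)
    (fun i i' h hs hs' => hs (hK h hs')) (fun h => b.ne_zero s ((tr_self _).symm.trans h))
  choose j hj using fun s : Fin r => Fin.exists_le_iff_of_monotone (p := fun j => b s ∈ U j)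
    (fun j j' h hs => hU h hs) ⟨b s, tr_self _⟩
  choose x hx using fun s => (hj s (j s)).1 le_rfl
  have hxv : ∀ s (q : Grid m (n + 1)) (h : Grid.pt 0 (j s) ≤ q),
      tr X (⟨le_rfl, hl q.2⟩ : q ≤ Grid.pt q.1 (Fin.last n)) (tr X h (x s)) = v q.1 (b s) := by
    intro s q h
    rw [← hx s]
    exact (tr_tr (X := X) h _ (x s)).trans (tr_tr (X := X) _ _ (x s)).symm
  have hx₀ : ∀ s (q : Grid m (n + 1)) (h : Grid.pt 0 (j s) ≤ q), ¬ q.1 ≤ i s →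
      tr X h (x s) = 0 := by
    intro s q h hq
    apply hM q.1 q.2 (Fin.last n) (Grid.pt_le_pt.2 ⟨le_rfl, hl q.2⟩)
    exact ((hxv s q h).trans (not_not.1 ((hi s q.1).not.1 hq))).trans (map_zero _).symm
  have hmem : ∀ s (p : Grid m (n + 1)), p ∈ Grid.corner (i s) (j s) ↔ b s ∉ K p.1 ∧ b s ∈ U p.2 :=
    fun s p => and_congr (hi s p.1) (hj s p.2)
  -- linear sections of the horizontal maps out of the first column
  have hzp : ∀ p : Grid m (n + 1), Grid.pt 0 p.2 ≤ p := fun p => ⟨hz _, le_rfl⟩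
  choose σ hσ using fun p : Grid m (n + 1) => LinearMap.exists_rightInverse_of_surjective
    (tr X (hzp p)) (LinearMap.range_eq_top.2 (hE 0 p.1 p.2 (hzp p)))
  replace hσ : ∀ p y, tr X (hzp p) (σ p y) = y := fun p y => LinearMap.congr_fun (hσ p) y
  let γ (s : Fin r) (p : Grid m (n + 1)) : X.obj p →ₗ[k] k :=
    if p ∈ Grid.corner (i s) (j s) then b.coord s ∘ₗ u p.2 ∘ₗ σ p else 0
  have hγ₀ : ∀ s p, p ∉ Grid.corner (i s) (j s) → γ s p = 0 := fun s p hp => if_neg hp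
  have hγ₁ : ∀ s p, p ∈ Grid.corner (i s) (j s) → ∀ y, γ s p y = b.repr (u p.2 (σ p y)) s := by
    intro s p hp y
    simp only [γ, if_pos hp]
    rfl
  have hγ : ∀ s p, p ∈ Grid.corner (i s) (j s) → ∀ y : X.obj (Grid.pt 0 p.2),
      γ s p (tr X (hzp p) y) = b.repr (u p.2 y) s := by
    intro s p hp y
    rw [hγ₁ s p hp, ← sub_eq_zero, ← Finsupp.sub_apply, ← map_sub, ← map_sub]
    refine hbK p.1 _ ?_ s ((hmem s p).1 hp).1
    have e : ∀ z : X.obj (Grid.pt 0 p.2), v p.1 (u p.2 z) =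
        tr X (⟨le_rfl, hl p.2⟩ : p ≤ Grid.pt p.1 (Fin.last n)) (tr X (hzp p) z) := by
      intro z
      exact (tr_tr _ _ _).trans (tr_tr _ _ _).symm
    change v p.1 (u p.2 _) = 0
    rw [e, map_sub, hσ, sub_self, map_zero]
  have hγn : ∀ s (p q : Grid m (n + 1)) (h : p ≤ q) (y : X.obj p), q ∈ Grid.corner (i s) (j s) →
      γ s q (tr X h y) = γ s p y := by
    intro s p q h y hq
    have e₁ : tr X h y = tr X (hzp q) (tr X (Grid.pt_le_pt.2 ⟨le_rfl, h.2⟩)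
        (σ p y)) := by
      conv_lhs => rw [← hσ p y]
      exact (tr_tr _ _ _).trans (tr_tr _ _ _).symm
    have e₂ : u q.2 (tr X (Grid.pt_le_pt.2 ⟨le_rfl, h.2⟩) (σ p y)) =
        u p.2 (σ p y) := tr_tr _ _ _
    rw [e₁, hγ s q hq, e₂]
    by_cases hp : p ∈ Grid.corner (i s) (j s)
    · rw [hγ₁ s p hp]
    · rw [hγ₀ s p hp, LinearMap.zero_apply]
      refine hbU p.2 _ ⟨σ p y, rfl⟩ s fun hs => hp ?_
      exact ⟨h.1.trans hq.1, (hj s p.2).2 hs⟩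
  let F (s : Fin r) : GridRep k m (n + 1) := thinRect k (i s) (j s)
  let π (s : Fin r) : X ⟶ F s := toThin (i s) (j s) (γ s) (hγ₀ s) (hγn s)
  let ι (s : Fin r) : F s ⟶ X := ofThin (i s) (x s) (hx₀ s)
  have htot : ∑ s, π s ≫ ι s = 𝟙 X := by
    apply hom_ext_of_compAt
    intro p y
    rw [compAt_sum]
    change ∑ s, γ s p y • extVec X (x s) p = y
    have hpl : p ≤ Grid.pt p.1 (Fin.last n) := ⟨le_rfl, hl p.2⟩
    apply hM p.1 p.2 (Fin.last n) hpl
    have e : tr X hpl y = v p.1 (u p.2 (σ p y)) := by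
      conv_lhs => rw [← hσ p y]
      exact (tr_tr _ _ _).trans (tr_tr _ _ _).symm
    refine Eq.trans ?_ e.symm
    conv_rhs => rw [← b.sum_repr (u p.2 (σ p y)), map_sum]
    refine (map_sum _ _ _).trans (Finset.sum_congr rfl fun s _ => ?_)
    refine (map_smul _ _ _).trans ?_
    rw [map_smul]
    by_cases hp : p ∈ Grid.corner (i s) (j s)
    · rw [hγ₁ s p hp, extVec_of_le (x s) (⟨hz _, hp.2⟩ : Grid.pt 0 (j s) ≤ p)]
      exact congrArg _ (hxv s p _)
    · rw [hγ₀ s p hp, LinearMap.zero_apply, zero_smul]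
      by_cases hs : b s ∈ U p.2
      · have h0 : v p.1 (b s) = 0 := by
          by_contra h
          exact hp ((hmem s p).2 ⟨h, hs⟩)
        rw [h0, smul_zero]
      · rw [hbU p.2 _ ⟨_, rfl⟩ s hs, zero_smul]
  have horth : ∀ s t, ι s ≫ π t = if h : s = t then eqToHom (congrArg F h) else 0 := by
    intro s t
    apply hom_ext_of_compAt
    intro p a
    apply Subtype.ext
    change γ t p (a.1 • extVec X (x s) p) = _
    rw [map_smul]
    by_cases hs : p ∈ Grid.corner (i s) (j s)
    · have hle : Grid.pt 0 (j s) ≤ Grid.pt 0 p.2 := ⟨le_rfl, hs.2⟩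
      have e₁ : extVec X (x s) p = tr X (hzp p) (tr X hle (x s)) := by
        rw [tr_tr, extVec_of_le]
      have e₂ : u p.2 (tr X hle (x s)) = b s := (tr_tr _ _ _).trans (hx s)
      rw [e₁]
      split_ifs with h
      · subst h
        rw [hγ s p hs, e₂, b.repr_self, Finsupp.single_eq_same, smul_eq_mul, mul_one]
        rfl
      · have : γ t p (tr X (hzp p) (tr X hle (x s))) = 0 := by
          by_cases ht : p ∈ Grid.corner (i t) (j t)
          · rw [hγ t p ht, e₂, b.repr_self, Finsupp.single_eq_of_ne' h]
          · rw [hγ₀ t p ht, LinearMap.zero_apply]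
        rw [this, smul_zero]
        rfl
    · have ha : a = 0 := Subtype.ext (thinRect_eq_zero hs a)
      rw [ha, map_zero]
      exact zero_smul k _
  refine ⟨r, i, j, ⟨{ hom := biproduct.lift π, inv := biproduct.desc ι, hom_inv_id := ?_,
                      inv_hom_id := ?_ }⟩⟩
  · rw [biproduct.lift_desc, htot]
  · refine biproduct.hom_ext' _ _ fun s => biproduct.hom_ext _ _ fun t => ?_
    rw [biproduct.ι_desc_assoc, Category.assoc, biproduct.lift_π, Category.comp_id,
      biproduct.ι_π]
    exact horth s t

theorem exists_iso_thinRect {X : GridRep k m (n + 1)} (hX : horizEpiVertMono k m (n + 1) X) :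
    ∃ (r : ℕ) (i : Fin r → Fin m) (j : Fin r → Fin (n + 1)),
      Nonempty (X ≅ ⨁ fun s : Fin r => thinRect k (i s) (j s)) := by
  rcases eq_or_ne m 0 with rfl | hm
  · have hP : IsEmpty (Grid 0 (n + 1)) := inferInstanceAs (IsEmpty (Fin 0 × Fin (n + 1)))
    exact ⟨0, Fin.elim0, Fin.elim0, ⟨{
      hom := mkHom (fun p => hP.elim p) fun p => hP.elim p
      inv := mkHom (fun p => hP.elim p) fun p => hP.elim p
      hom_inv_id := hom_ext_of_compAt fun p => hP.elim p
      inv_hom_id := hom_ext_of_compAt fun p => hP.elim p }⟩⟩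
  · have : NeZero m := ⟨hm⟩
    exact exists_iso_thinRect_of_neZero hX

end Decomposition

/-! ### Image diagrams and kernels -/

section Image

variable {k : Type u} [Field k] {P : Type*} [PartialOrder P] {X Y Z : P ⥤ FGModuleCat.{u} k}

/-- The representation formed by the images of the components of a morphism. -/
def imageDiagram (φ : X ⟶ Y) : P ⥤ FGModuleCat.{u} k :=
  mkRep (fun p => LinearMap.range (compAt φ p))
    (fun h => (tr Y h).restrict (by
      rintro _ ⟨x, rfl⟩
      exact ⟨tr X h x, compAt_tr φ h x⟩))
    (fun p x => Subtype.ext (tr_self _)) (fun p q r h h' x => Subtype.ext (tr_tr _ _ _))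

/-- The corestriction of a morphism to its image. -/
def toImage (φ : X ⟶ Y) : X ⟶ imageDiagram φ :=
  mkHom (fun p => (compAt φ p).rangeRestrict) fun _ _ h x => Subtype.ext (compAt_tr φ h x)

theorem compAt_toImage_eq_zero_iff (φ : X ⟶ Y) (p : P) (x : X.obj p) :
    compAt (toImage φ) p x = 0 ↔ compAt φ p x = 0 :=
  Subtype.ext_iff

theorem toImage_surjective (φ : X ⟶ Y) (p : P) : Function.Surjective (compAt (toImage φ) p) :=
  LinearMap.surjective_rangeRestrict _

/-- A morphism vanishing on the kernel of a componentwise surjective morphism factors through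
it. -/
theorem exists_factor_of_surjective (q : X ⟶ Z) (hq : ∀ p, Function.Surjective (compAt q p))
    (f : X ⟶ Y) (hf : ∀ p x, compAt q p x = 0 → compAt f p x = 0) : ∃ g : Z ⟶ Y, q ≫ g = f := by
  choose σ hσ using fun p => LinearMap.exists_rightInverse_of_surjective (compAt q p)
    (LinearMap.range_eq_top.2 (hq p))
  replace hσ : ∀ p z, compAt q p (σ p z) = z := fun p z => LinearMap.congr_fun (hσ p) z
  have key : ∀ p x, compAt f p (σ p (compAt q p x)) = compAt f p x := by
    intro p x
    rw [← sub_eq_zero, ← map_sub]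
    apply hf
    rw [map_sub, hσ, sub_self]
  refine ⟨mkHom (fun p => compAt f p ∘ₗ σ p) fun p r h z => ?_, hom_ext_of_compAt key⟩
  obtain ⟨x, rfl⟩ := hq p z
  rw [LinearMap.comp_apply, LinearMap.comp_apply, key, ← compAt_tr, key, compAt_tr]

theorem compAt_kernelDiagram (φ : X ⟶ Y) {p : P} (x : (kernelDiagram φ).obj p) :
    compAt φ p x.1 = 0 := x.2

end Image

section LastRow

variable {k : Type u} [Field k] {m n : ℕ}

theorem Grid.le_last (p : Grid m (n + 1)) : p ≤ Grid.pt p.1 (Fin.last n) :=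
  ⟨le_rfl, Fin.le_last _⟩

/-- The projection of a grid to its last row. -/
def Grid.lastRow (m n : ℕ) : Grid m (n + 1) ⥤ Grid m (n + 1) :=
  Monotone.functor (f := fun p : Grid m (n + 1) => Grid.pt p.1 (Fin.last n)) fun _ _ h =>
    Grid.pt_le_pt.2 ⟨h.1, le_rfl⟩

/-- The morphism from a representation to its last row, repeated in all rows. -/
def toLast (X : GridRep k m (n + 1)) : X ⟶ Grid.lastRow m n ⋙ X :=
  mkHom (fun p => tr X p.le_last) fun _ _ _ x => (tr_tr _ _ x).trans (tr_tr _ _ x).symm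

theorem compAt_toLast (X : GridRep k m (n + 1)) (p : Grid m (n + 1)) (x : X.obj p) :
    compAt (toLast X) p x = tr X p.le_last x := rfl

theorem horizEpiVertMono_imageDiagram {X : GridRep k m (n + 1)}
    (hX : horizEpi k m (n + 1) X) :
    horizEpiVertMono k m (n + 1) (imageDiagram (toLast X)) := by
  refine ⟨horizEpi_iff.2 fun i i' j h y => ?_, vertMono_iff.2 fun i j j' h x y hxy => ?_⟩
  · obtain ⟨z, rfl⟩ := toImage_surjective (toLast X) _ y
    obtain ⟨x, rfl⟩ := horizEpi_iff.1 hX i i' j h z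
    exact ⟨compAt (toImage (toLast X)) _ x, (compAt_tr _ _ _).symm⟩
  · -- vertical maps of the last row, repeated in all rows, are identities
    have e : ∀ z : (imageDiagram (toLast X)).obj (Grid.pt i j),
        (tr (imageDiagram (toLast X)) h z).1 = z.1 := fun z => tr_self (X := X) z.1
    apply Subtype.ext
    rw [← e x, ← e y, hxy]

theorem kernelFunctor_map_eq_iff {X Y : GridRep k m (n + 1)} (f g : X ⟶ Y) :
    (kernelFunctor k m n).map f = (kernelFunctor k m n).map g ↔
      ∀ p x, compAt (toLast X) p x = 0 → compAt (f - g) p x = 0 := by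
  constructor
  · rintro h ⟨i, j⟩ x hx
    induction j using Fin.lastCases with
    | last =>
      have h0 : x = 0 := (tr_self (X := X) x).symm.trans hx
      rw [h0, map_zero]
    | cast j =>
      have e := congrArg (fun φ : (kernelFunctor k m n).obj X ⟶ (kernelFunctor k m n).obj Y =>
        (compAt φ (Grid.pt i j) ⟨x, hx⟩).1) h
      exact sub_eq_zero.2 e
  · intro h
    apply hom_ext_of_compAt
    intro p x
    exact Subtype.ext (sub_eq_zero.1 (h _ x.1 x.2))

/-- Morphisms whose difference factors through a representation with monic vertical maps agree on
kernels, and conversely the difference of morphisms that agree on kernels factors through the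
images of the maps to the last row. -/
theorem factorRel_iff {X Y : RepEStar k m (n + 1)} (f g : X ⟶ Y) :
    factorRel (repEM k m (n + 1)) f g ↔ (tFunctor k m n).map f = (tFunctor k m n).map g := by
  refine Iff.trans ?_ (kernelFunctor_map_eq_iff f.hom g.hom).symm
  constructor
  · rintro ⟨Z, hZ, a, b, hab⟩ p x hx
    have e : f.hom - g.hom = a.hom ≫ b.hom := congrArg (fun φ => φ.hom) hab.symm
    have h0 : compAt a.hom p x = 0 := by
      apply vertMono_iff.1 hZ.2 p.1 p.2 (Fin.last n) p.le_last
      refine (compAt_tr a.hom p.le_last x).symm.trans ?_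
      rw [compAt_toLast] at hx
      rw [hx]
      exact (map_zero _).trans (map_zero _).symm
    rw [e, compAt_comp, h0, map_zero]
  · intro h
    obtain ⟨b, hb⟩ := exists_factor_of_surjective (toImage (toLast X.obj))
      (toImage_surjective _) (f.hom - g.hom)
      fun p x hx => h p x ((compAt_toImage_eq_zero_iff _ p x).1 hx)
    have hI := horizEpiVertMono_imageDiagram X.property
    exact ⟨⟨imageDiagram (toLast X.obj), hI.1⟩, hI, ObjectProperty.homMk (toImage _),
      ObjectProperty.homMk b, ObjectProperty.hom_ext _ hb⟩

end LastRow

/-! ### Extension of morphisms -/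

section Extension

variable {k : Type u} [Field k] {m n : ℕ}

theorem compAt_eq_smul_extVec [NeZero m] {X : GridRep k m n} {i : Fin m} {j : Fin n}
    (f : thinRect k i j ⟶ X) (g : (thinRect k i j).obj (Grid.pt 0 j)) (hg : g.1 = 1)
    (p : Grid m n) (a : (thinRect k i j).obj p) :
    compAt f p a = a.1 • extVec X (compAt f _ g) p := by
  rw [← compAt_extVec, ← map_smul]
  congr 1
  apply Subtype.ext
  by_cases hp : p ∈ Grid.corner i j
  · have h : Grid.pt 0 j ≤ p := ⟨Fin.zero_le _, hp.2⟩
    rw [extVec_of_le g h]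
    change a.1 = a.1 • (tr (thinRect k i j) h g).1
    rw [tr_thinRect_of_mem h hp, hg, smul_eq_mul, mul_one]
  · rw [thinRect_eq_zero hp, thinRect_eq_zero hp]

/-- The relation `x = 0` to the right of column `i`, which defines the thin modules, can be lifted
along the horizontal epimorphisms of `Y`: a vector `y` of `Y` in position `(1, j)` can be chosen so
that it has prescribed compatible images to the right of column `i`. -/
theorem exists_lift_column [NeZero m] {Y : GridRep k m n} (hY : horizEpi k m n Y) (i : Fin m)
    (j : Fin n) (y : ∀ q : Grid m n, Grid.pt 0 j ≤ q → ¬ q.1 ≤ i → Y.obj q)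
    (hy : ∀ p q (h : Grid.pt 0 j ≤ p) (hp : ¬ p.1 ≤ i) (h' : p ≤ q) (hq : ¬ q.1 ≤ i),
      tr Y h' (y p h hp) = y q (h.trans h') hq) :
    ∃ z : Y.obj (Grid.pt 0 j), ∀ q h hq, tr Y h z = y q h hq := by
  by_cases hi : i.1 + 1 < m
  · have h₁ : Grid.pt 0 j ≤ Grid.pt (⟨i.1 + 1, hi⟩ : Fin m) j := ⟨Fin.zero_le _, le_rfl⟩
    have hn : ¬ (Grid.pt (⟨i.1 + 1, hi⟩ : Fin m) j).1 ≤ i :=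
      not_le.2 (Fin.lt_def.2 (Nat.lt_succ_self _))
    obtain ⟨z, hz⟩ := horizEpi_iff.1 hY 0 ⟨i.1 + 1, hi⟩ j h₁ (y _ h₁ hn)
    refine ⟨z, fun q h hq => ?_⟩
    have h₂ : Grid.pt (⟨i.1 + 1, hi⟩ : Fin m) j ≤ q :=
      ⟨Fin.le_def.2 (Nat.succ_le_of_lt (Fin.lt_def.1 (not_le.1 hq))), h.2⟩
    rw [← hy _ q h₁ hn h₂ hq, ← hz, tr_tr]
  · refine ⟨0, fun q h hq => absurd (Fin.le_def.2 ?_) hq⟩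
    have := q.1.2
    omega

/-- The vanishing of `Ext¹(Z, Y)` for `Z` in `rep^{e,m}` and `Y` in `rep^{e,*}`: a morphism to `Y`
from the kernel of a surjection `q : X ⟶ Z` extends to `X`.  Split `Z` into thin modules, with
generators `β s`; lift them to vectors `x s` of `X`.  To the right of their rectangles these vectors
lie in the kernel of `q`, and since the horizontal maps of `Y` are surjective there are vectors
`y s` of `Y` whose images there are those prescribed by `ψ`.  The extension maps `x s` to `y s`. -/
theorem exists_extension_of_neZero [NeZero m] {X Y Z : GridRep k m (n + 1)} (q : X ⟶ Z)
    (hq : ∀ p, Function.Surjective (compAt q p)) (hZ : horizEpiVertMono k m (n + 1) Z)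
    (hY : horizEpi k m (n + 1) Y) (ψ : kernelDiagram q ⟶ Y) :
    ∃ f : X ⟶ Y, ∀ p (x : (kernelDiagram q).obj p), compAt f p x.1 = compAt ψ p x := by
  obtain ⟨r, i, j, ⟨e⟩⟩ := exists_iso_thinRect hZ
  obtain ⟨π, σ, hπσ⟩ := exists_sum_eq_id_of_iso e
  have hsum : ∀ (p : Grid m (n + 1)) (z : Z.obj p), ∑ s, compAt (σ s) p (compAt (π s) p z) = z := by
    intro p z
    conv_rhs => rw [← compAt_id p z, ← hπσ, compAt_sum]
    rfl
  let g (s : Fin r) : (thinRect k (i s) (j s)).obj (Grid.pt 0 (j s)) :=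
    ⟨1, thinRect_mem (p := Grid.pt 0 (j s)) ⟨Fin.zero_le _, le_rfl⟩ 1⟩
  let β (s : Fin r) : Z.obj (Grid.pt 0 (j s)) := compAt (σ s) _ (g s)
  have hβ : ∀ s p a, compAt (σ s) p a = a.1 • extVec Z (β s) p := fun s p a =>
    compAt_eq_smul_extVec (σ s) (g s) rfl p a
  choose x hx using fun s => hq _ (β s)
  have hxker : ∀ s p (h : Grid.pt 0 (j s) ≤ p), ¬ p.1 ≤ i s → compAt q p (tr X h (x s)) = 0 := by
    intro s p h hp
    have h0 : tr (thinRect k (i s) (j s)) h (g s) = 0 :=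
      Subtype.ext (thinRect_eq_zero (fun hp' => hp hp'.1) _)
    rw [compAt_tr, hx, ← compAt_tr, h0, map_zero]
  choose y hy using fun s => exists_lift_column hY (i s) (j s)
    (fun p h hp => compAt ψ p ⟨tr X h (x s), hxker s p h hp⟩) (fun p p' h hp h' hp' =>
      (compAt_tr ψ h' ⟨tr X h (x s), hxker s p h hp⟩).symm.trans
        (congrArg (compAt ψ p') (Subtype.ext (tr_tr h h' (x s)))))
  -- the coordinates of the image in `Z`, and the projection to the kernel of `q`
  let γ (s : Fin r) (p : Grid m (n + 1)) : X.obj p →ₗ[k] k :=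
    (constSpace k (Grid.corner (i s) (j s)) p).subtype ∘ₗ compAt (π s) p ∘ₗ compAt q p
  have hγ₀ : ∀ s p, p ∉ Grid.corner (i s) (j s) → ∀ v, γ s p v = 0 := fun s p hp v =>
    thinRect_eq_zero hp _
  have hγ : ∀ s (p p' : Grid m (n + 1)) (h : p ≤ p'), p' ∈ Grid.corner (i s) (j s) → ∀ v,
      γ s p' (tr X h v) = γ s p v := by
    intro s p p' h hp' v
    change (compAt (π s) p' (compAt q p' (tr X h v))).1 = (compAt (π s) p (compAt q p v)).1
    rw [compAt_tr, compAt_tr, tr_thinRect_of_mem h hp']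
  let ρ (p : Grid m (n + 1)) : X.obj p →ₗ[k] LinearMap.ker (compAt q p) :=
    (LinearMap.id - ∑ s, (LinearMap.toSpanSingleton k _ (extVec X (x s) p)) ∘ₗ γ s p).codRestrict
      _ fun v => by
        rw [LinearMap.mem_ker, LinearMap.sub_apply, map_sub, sub_eq_zero, LinearMap.sum_apply,
          map_sum]
        refine (hsum p (compAt q p v)).symm.trans (Finset.sum_congr rfl fun s _ => ?_)
        rw [hβ, LinearMap.comp_apply, LinearMap.toSpanSingleton_apply, map_smul, compAt_extVec, hx]
        rfl
  have hρ : ∀ p v, (ρ p v).1 = v - ∑ s, γ s p v • extVec X (x s) p := by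
    intro p v
    change v - (∑ s, (LinearMap.toSpanSingleton k _ (extVec X (x s) p)) ∘ₗ γ s p) v = _
    rw [LinearMap.sum_apply]
    rfl
  let F (p : Grid m (n + 1)) : X.obj p →ₗ[k] Y.obj p :=
    ∑ s, (LinearMap.toSpanSingleton k _ (extVec Y (y s) p)) ∘ₗ γ s p + compAt ψ p ∘ₗ ρ p
  have hF : ∀ p v, F p v = ∑ s, γ s p v • extVec Y (y s) p + compAt ψ p (ρ p v) := by
    intro p v
    rw [LinearMap.add_apply, LinearMap.sum_apply]
    rfl
  have key : ∀ (p p' : Grid m (n + 1)) (h : p ≤ p') (v : X.obj p) (s : Fin r),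
      ∃ d : (kernelDiagram q).obj p',
        d.1 = γ s p v • tr X h (extVec X (x s) p) - γ s p' (tr X h v) • extVec X (x s) p' ∧
        compAt ψ p' d =
          γ s p v • tr Y h (extVec Y (y s) p) - γ s p' (tr X h v) • extVec Y (y s) p' := by
    intro p p' h v s
    by_cases hp : p ∈ Grid.corner (i s) (j s)
    · rw [tr_extVec _ hp.2, tr_extVec _ hp.2]
      by_cases hp' : p' ∈ Grid.corner (i s) (j s)
      · refine ⟨0, ?_, ?_⟩ <;> rw [hγ s p p' h hp', sub_self]
        · rfl
        · exact map_zero _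
      · have hle : Grid.pt 0 (j s) ≤ p' := ⟨Fin.zero_le _, hp.2.trans h.2⟩
        have hi : ¬ p'.1 ≤ i s := fun hi => hp' ⟨hi, hle.2⟩
        refine ⟨γ s p v • ⟨tr X hle (x s), hxker s p' hle hi⟩, ?_, ?_⟩ <;>
          rw [hγ₀ s p' hp', zero_smul, sub_zero, extVec_of_le _ hle]
        · rfl
        · rw [hy s p' hle hi]
          exact map_smul _ _ _
    · have h0 : γ s p' (tr X h v) = 0 := by
        by_cases hp' : p' ∈ Grid.corner (i s) (j s)
        · rw [hγ s p p' h hp', hγ₀ s p hp]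
        · exact hγ₀ s p' hp' _
      refine ⟨0, ?_, ?_⟩ <;> rw [h0, hγ₀ s p hp, zero_smul, zero_smul, sub_zero]
      · rfl
      · exact map_zero _
  refine ⟨mkHom F fun p p' h v => ?_, fun p v => ?_⟩
  · choose d hd₁ hd₂ using key p p' h v
    have hρ' : ρ p' (tr X h v) = tr (kernelDiagram q) h (ρ p v) + ∑ s, d s := by
      apply Subtype.ext
      have e₁ : (tr (kernelDiagram q) h (ρ p v) + ∑ s, d s).1 =
          tr X h (ρ p v).1 + ∑ s, (d s).1 := by
        refine congrArg₂ (· + ·) rfl ?_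
        exact map_sum (LinearMap.ker (compAt q p')).subtype d Finset.univ
      refine Eq.trans ?_ e₁.symm
      simp_rw [hd₁]
      rw [Finset.sum_sub_distrib, hρ, hρ, map_sub, map_sum]
      simp_rw [map_smul]
      abel
    have hψ : compAt ψ p' (tr (kernelDiagram q) h (ρ p v)) = tr Y h (compAt ψ p (ρ p v)) :=
      compAt_tr ψ h (ρ p v)
    rw [hF, hF, hρ', map_add, map_add, map_sum, map_sum, hψ]
    simp_rw [hd₂, map_smul]
    rw [Finset.sum_sub_distrib]
    abel
  · have h0 : ∀ s, γ s p v.1 = 0 := by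
      intro s
      change (compAt (π s) p (compAt q p v.1)).1 = 0
      rw [compAt_kernelDiagram, map_zero]
      rfl
    have hρv : ρ p v.1 = v := Subtype.ext (by simp [hρ, h0])
    rw [compAt_mkHom, hF, hρv]
    simp [h0]

theorem exists_extension {X Y Z : GridRep k m (n + 1)} (q : X ⟶ Z)
    (hq : ∀ p, Function.Surjective (compAt q p)) (hZ : horizEpiVertMono k m (n + 1) Z)
    (hY : horizEpi k m (n + 1) Y) (ψ : kernelDiagram q ⟶ Y) :
    ∃ f : X ⟶ Y, ∀ p (x : (kernelDiagram q).obj p), compAt f p x.1 = compAt ψ p x := by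
  rcases eq_or_ne m 0 with rfl | hm
  · have hP : IsEmpty (Grid 0 (n + 1)) := inferInstanceAs (IsEmpty (Fin 0 × Fin (n + 1)))
    exact ⟨mkHom (fun p => hP.elim p) fun p => hP.elim p, fun p => hP.elim p⟩
  · have : NeZero m := ⟨hm⟩
    exact exists_extension_of_neZero q hq hZ hY ψ

end Extension

/-! ### Fullness of the kernel functor -/

section Full

variable {k : Type u} [Field k] {m n : ℕ}

/-- A morphism of the diagrams of kernels, extended by zero to the last row. -/
theorem exists_kernelDiagram_hom {X Y : GridRep k m (n + 1)}
    (φ : (kernelFunctor k m n).obj X ⟶ (kernelFunctor k m n).obj Y) :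
    ∃ ψ : kernelDiagram (toImage (toLast X)) ⟶ Y,
      ∀ (p : Grid m n) (x : ((kernelFunctor k m n).obj X).obj p),
        compAt ψ ((Grid.initRows m n).obj p)
          ⟨x.1, (compAt_toImage_eq_zero_iff (toLast X) ((Grid.initRows m n).obj p) x.1).2 x.2⟩ =
          (compAt φ p x).1 := by
  let K : GridRep k m (n + 1) := kernelDiagram (toImage (toLast X))
  have hK : ∀ (p : Grid m (n + 1)) (x : K.obj p), compAt (toLast X) p x.1 = 0 := fun p x =>
    (compAt_toImage_eq_zero_iff (toLast X) p x.1).1 x.2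
  let L (p : Grid m n) :
      K.obj ((Grid.initRows m n).obj p) →ₗ[k] Y.obj ((Grid.initRows m n).obj p) :=
    (LinearMap.ker (compAt (toLast Y) ((Grid.initRows m n).obj p))).subtype ∘ₗ compAt φ p ∘ₗ
      ((LinearMap.ker (compAt (toImage (toLast X)) ((Grid.initRows m n).obj p))).subtype.codRestrict
        (LinearMap.ker (compAt (toLast X) ((Grid.initRows m n).obj p))) fun x => hK _ x)
  have hL : ∀ p x, L p x = (compAt φ p ⟨x.1, hK _ x⟩).1 := fun p x => rfl
  have hL₀ : ∀ p x, tr Y (Grid.le_last _) (L p x) = 0 := fun p x => (compAt φ p ⟨x.1, hK _ x⟩).2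
  -- by eta, a position `p` before the last row is definitionally in the image of `Grid.initRows`
  let ψ (p : Grid m (n + 1)) : K.obj p →ₗ[k] Y.obj p :=
    if h : p.2.1 < n then L (Grid.pt p.1 ⟨p.2.1, h⟩) else 0
  have hψ₁ : ∀ p (h : p.2.1 < n) x, ψ p x = L (Grid.pt p.1 ⟨p.2.1, h⟩) x := fun p h x =>
    LinearMap.congr_fun (dif_pos h : ψ p = L (Grid.pt p.1 ⟨p.2.1, h⟩)) x
  have hψ₀ : ∀ p, ¬ p.2.1 < n → ∀ x, ψ p x = 0 := fun p h x =>
    LinearMap.congr_fun (dif_neg h : ψ p = 0) x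
  refine ⟨mkHom ψ fun p q h x => ?_, fun p x => ?_⟩
  · by_cases hq : q.2.1 < n
    · have hp : p.2.1 < n := lt_of_le_of_lt (Fin.le_def.1 h.2) hq
      rw [hψ₁ q hq, hψ₁ p hp]
      have hle : Grid.pt p.1 (⟨p.2.1, hp⟩ : Fin n) ≤ Grid.pt q.1 ⟨q.2.1, hq⟩ := h
      exact congrArg Subtype.val (compAt_tr φ hle ⟨x.1, hK p x⟩)
    · rw [hψ₀ q hq]
      by_cases hp : p.2.1 < n
      · rw [hψ₁ p hp]
        have hle : Grid.pt p.1 (Fin.last n) ≤ q := ⟨h.1, Fin.le_def.2 (not_lt.1 hq)⟩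
        refine Eq.trans ?_ (tr_tr (X := Y) (Grid.le_last p) hle _)
        exact (map_zero _).symm.trans (congrArg _ (hL₀ (Grid.pt p.1 ⟨p.2.1, hp⟩) x).symm)
      · rw [hψ₀ p hp, map_zero]
  · have hp : ((Grid.initRows m n).obj p).2.1 < n := p.2.2
    exact (hψ₁ _ hp _).trans (hL p _)

theorem exists_kernelFunctor_map_eq {X Y : GridRep k m (n + 1)} (hX : horizEpi k m (n + 1) X)
    (hY : horizEpi k m (n + 1) Y)
    (φ : (kernelFunctor k m n).obj X ⟶ (kernelFunctor k m n).obj Y) :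
    ∃ f : X ⟶ Y, (kernelFunctor k m n).map f = φ := by
  obtain ⟨ψ, hψ⟩ := exists_kernelDiagram_hom φ
  obtain ⟨f, hf⟩ := exists_extension (toImage (toLast X)) (toImage_surjective _)
    (horizEpiVertMono_imageDiagram hX) hY ψ
  refine ⟨f, hom_ext_of_compAt fun p x => Subtype.ext ?_⟩
  exact (hf _ ⟨x.1, (compAt_toImage_eq_zero_iff (toLast X) _ x.1).2 x.2⟩).trans (hψ p x)

end Full

/-! ### Essential surjectivity of the kernel functor -/

section EssSurj

theorem isIso_of_compAt_bijective {k : Type u} [Field k] {P : Type*} [PartialOrder P]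
    {X Y : P ⥤ FGModuleCat.{u} k} (f : X ⟶ Y) (hf : ∀ p, Function.Bijective (compAt f p)) :
    IsIso f := by
  let e (p : P) : X.obj p ≃ₗ[k] Y.obj p := LinearEquiv.ofBijective (compAt f p) (hf p)
  have he : ∀ p x, compAt f p x = e p x := fun p x => rfl
  refine ⟨mkHom (fun p => (e p).symm.toLinearMap) fun p q h y => ?_,
    hom_ext_of_compAt fun p x => (e p).symm_apply_apply x,
    hom_ext_of_compAt fun p y => (e p).apply_symm_apply y⟩
  apply (e q).injective
  rw [LinearEquiv.coe_coe, LinearEquiv.coe_coe, LinearEquiv.apply_symm_apply, ← he, compAt_tr, he,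
    LinearEquiv.apply_symm_apply]

instance (m n : ℕ) : Finite (Grid m n) := inferInstanceAs (Finite (Fin m × Fin n))

variable {k : Type u} [Field k] {m n : ℕ} (Z : GridRep k m n)

theorem Grid.initRows_le {p q : Grid m n} :
    (Grid.initRows m n).obj p ≤ (Grid.initRows m n).obj q ↔ p ≤ q := Iff.rfl

theorem Grid.pt_fst_le (q : Grid m n) {a : Fin m} (h : a ≤ q.1) : Grid.pt a q.2 ≤ q :=
  ⟨h, le_rfl⟩

/-- The ambient vector space of the representation `horizHull`. -/
abbrev HullSpace : Type u := (∀ q : Grid m n, Z.obj q) × (Fin m → ∀ q : Grid m n, Z.obj q)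

/-- The space in position `p` of the representation `horizHull`.  It consists of the pairs
`(e, g)`, where `e` is supported above and to the right of `p` and is compatible with the vertical
maps there, and `g a (i, j)` is supported where `a` and `i ≥ a` are not to the left of `p`; in the
rows from `p` on, `g` is determined by `e` as the failure `g a (i, j) = e (i, j) - Z (e (a, j))` of
`e` to be compatible with the horizontal maps, while it is arbitrary in the rows before. -/
def hullSubmodule (p : Grid m (n + 1)) : Submodule k (HullSpace Z) where
  carrier := {w |
    (∀ q, ¬ p ≤ (Grid.initRows m n).obj q → w.1 q = 0) ∧
    (∀ (c : Fin m) (j j' : Fin n) (h : Grid.pt c j ≤ Grid.pt c j'),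
      p ≤ (Grid.initRows m n).obj (Grid.pt c j) →
        w.1 (Grid.pt c j') = tr Z h (w.1 (Grid.pt c j))) ∧
    (∀ (a : Fin m) (q : Grid m n), ¬ (p.1 ≤ a ∧ a ≤ q.1) → w.2 a q = 0) ∧
    (∀ (a : Fin m) (q : Grid m n) (h : a ≤ q.1),
      p ≤ (Grid.initRows m n).obj (Grid.pt a q.2) →
        w.2 a q = w.1 q - tr Z (q.pt_fst_le h) (w.1 (Grid.pt a q.2)))}
  add_mem' := by
    rintro v w ⟨hv₁, hv₂, hv₃, hv₄⟩ ⟨hw₁, hw₂, hw₃, hw₄⟩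
    refine ⟨fun q h => ?_, fun c j j' h h' => ?_, fun a q h => ?_, fun a q h h' => ?_⟩
    · exact (congrArg₂ (· + ·) (hv₁ q h) (hw₁ q h)).trans (add_zero 0)
    · exact (congrArg₂ (· + ·) (hv₂ c j j' h h') (hw₂ c j j' h h')).trans (map_add _ _ _).symm
    · exact (congrArg₂ (· + ·) (hv₃ a q h) (hw₃ a q h)).trans (add_zero 0)
    · refine (congrArg₂ (· + ·) (hv₄ a q h h') (hw₄ a q h h')).trans ?_
      rw [Prod.fst_add, Pi.add_apply, Pi.add_apply, map_add]
      abel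
  zero_mem' := by
    refine ⟨fun q h => rfl, fun c j j' h h' => (map_zero _).symm, fun a q h => rfl,
      fun a q h h' => ?_⟩
    exact ((congrArg _ (map_zero _)).trans (sub_zero _)).symm
  smul_mem' := by
    rintro c w ⟨hw₁, hw₂, hw₃, hw₄⟩
    refine ⟨fun q h => ?_, fun _ j j' h h' => ?_, fun a q h => ?_, fun a q h h' => ?_⟩
    · exact (congrArg (c • ·) (hw₁ q h)).trans (smul_zero c)
    · exact (congrArg (c • ·) (hw₂ _ j j' h h')).trans (map_smul _ _ _).symm
    · exact (congrArg (c • ·) (hw₃ a q h)).trans (smul_zero c)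
    · refine (congrArg (c • ·) (hw₄ a q h h')).trans ?_
      rw [Prod.smul_fst, Pi.smul_apply, Pi.smul_apply, map_smul, smul_sub]

open Classical in
/-- The truncation of a pair `(e, g)`: the function `e` is restricted to the positions above and
to the right of `p`, and `g a` to those `a` that are not to the left of `p`. -/
def hullTrunc (p : Grid m (n + 1)) : HullSpace Z →ₗ[k] HullSpace Z where
  toFun w := (fun q => if p ≤ (Grid.initRows m n).obj q then w.1 q else 0,
    fun a q => if p.1 ≤ a then w.2 a q else 0)
  map_add' v w := by
    ext
    · simp only [Prod.fst_add, Pi.add_apply]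
      split_ifs <;> simp
    · simp only [Prod.snd_add, Pi.add_apply]
      split_ifs <;> simp
  map_smul' c w := by
    ext
    · simp only [Prod.smul_fst, Pi.smul_apply, RingHom.id_apply]
      split_ifs <;> simp
    · simp only [Prod.smul_snd, Pi.smul_apply, RingHom.id_apply]
      split_ifs <;> simp

variable {Z}

theorem hullTrunc_fst_of_le {p : Grid m (n + 1)} (w : HullSpace Z) {q : Grid m n}
    (h : p ≤ (Grid.initRows m n).obj q) : (hullTrunc Z p w).1 q = w.1 q := if_pos h

theorem hullTrunc_fst_of_not_le {p : Grid m (n + 1)} (w : HullSpace Z) {q : Grid m n}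
    (h : ¬ p ≤ (Grid.initRows m n).obj q) : (hullTrunc Z p w).1 q = 0 := if_neg h

theorem hullTrunc_snd_of_le {p : Grid m (n + 1)} (w : HullSpace Z) {a : Fin m} (q : Grid m n)
    (h : p.1 ≤ a) : (hullTrunc Z p w).2 a q = w.2 a q := if_pos h

theorem hullTrunc_snd_of_not_le {p : Grid m (n + 1)} (w : HullSpace Z) {a : Fin m} (q : Grid m n)
    (h : ¬ p.1 ≤ a) : (hullTrunc Z p w).2 a q = 0 := if_neg h

theorem HullSpace.ext {v w : HullSpace Z} (h₁ : ∀ q, v.1 q = w.1 q)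
    (h₂ : ∀ a q, v.2 a q = w.2 a q) : v = w :=
  Prod.ext (funext h₁) (funext fun a => funext (h₂ a))

theorem hullTrunc_mem {p p' : Grid m (n + 1)} (h : p ≤ p') {w : HullSpace Z}
    (hw : w ∈ hullSubmodule Z p) : hullTrunc Z p' w ∈ hullSubmodule Z p' := by
  obtain ⟨h₁, h₂, h₃, h₄⟩ := hw
  refine ⟨fun q hq => hullTrunc_fst_of_not_le w hq, fun c j j' hj hc => ?_, fun a q hq => ?_,
    fun a q ha hq => ?_⟩
  · rw [hullTrunc_fst_of_le w hc, hullTrunc_fst_of_le w (hc.trans (Grid.initRows_le.2 hj))]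
    exact h₂ c j j' hj (h.trans hc)
  · by_cases hp : p'.1 ≤ a
    · rw [hullTrunc_snd_of_le w q hp]
      exact h₃ a q fun ha => hq ⟨hp, ha.2⟩
    · exact hullTrunc_snd_of_not_le w q hp
  · rw [hullTrunc_fst_of_le w hq,
      hullTrunc_fst_of_le w (hq.trans (Grid.initRows_le.2 (q.pt_fst_le ha)))]
    exact (hullTrunc_snd_of_le (p := p') w q hq.1).trans (h₄ a q ha (h.trans hq))

theorem hullTrunc_of_mem {p : Grid m (n + 1)} {w : HullSpace Z} (hw : w ∈ hullSubmodule Z p) :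
    hullTrunc Z p w = w := by
  apply HullSpace.ext
  · intro q
    by_cases hq : p ≤ (Grid.initRows m n).obj q
    · exact hullTrunc_fst_of_le w hq
    · rw [hullTrunc_fst_of_not_le w hq, hw.1 q hq]
  · intro a q
    by_cases ha : p.1 ≤ a
    · exact hullTrunc_snd_of_le w q ha
    · rw [hullTrunc_snd_of_not_le w q ha, hw.2.2.1 a q fun h => ha h.1]

theorem hullTrunc_hullTrunc {p p' : Grid m (n + 1)} (h : p ≤ p') (w : HullSpace Z) :
    hullTrunc Z p' (hullTrunc Z p w) = hullTrunc Z p' w := by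
  apply HullSpace.ext
  · intro q
    by_cases hq : p' ≤ (Grid.initRows m n).obj q
    · rw [hullTrunc_fst_of_le _ hq, hullTrunc_fst_of_le _ hq, hullTrunc_fst_of_le _ (h.trans hq)]
    · rw [hullTrunc_fst_of_not_le _ hq, hullTrunc_fst_of_not_le _ hq]
  · intro a q
    by_cases ha : p'.1 ≤ a
    · rw [hullTrunc_snd_of_le _ q ha, hullTrunc_snd_of_le _ q ha,
        hullTrunc_snd_of_le _ q (h.1.trans ha)]
    · rw [hullTrunc_snd_of_not_le _ q ha, hullTrunc_snd_of_not_le _ q ha]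

variable (Z) in
/-- A representation with epic horizontal maps whose diagram of kernels is `Z`.  In a row, `Z` is
the kernel of the map sending a family `e` of vectors to its failure `g` to be compatible with the
horizontal maps, and families and failures are restricted surjectively along horizontal maps.  The
vertical maps truncate `e`, but retain `g`, so that only compatible families die in the last
row. -/
def horizHull : GridRep k m (n + 1) :=
  mkRep (fun p => hullSubmodule Z p)
    (fun {_ p'} h => (hullTrunc Z p').restrict fun _ hw => hullTrunc_mem h hw)
    (fun _ w => Subtype.ext (hullTrunc_of_mem w.2))
    (fun _ _ _ _ h' w => Subtype.ext (hullTrunc_hullTrunc h' w.1))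

variable (Z) in
theorem horizEpi_horizHull : horizEpi k m (n + 1) (horizHull Z) := by
  classical
  refine horizEpi_iff.2 fun i i' j h w => ?_
  obtain ⟨⟨e, g⟩, h₁, h₂, h₃, h₄⟩ := w
  dsimp only at h₁ h₂ h₃ h₄
  -- a preimage has the same `e`, which vanishes in the new columns `i ≤ a < i'`; there the
  -- failures of compatibility are the values of `e` themselves
  let g' : Fin m → ∀ q : Grid m n, Z.obj q := fun a q =>
    if i' ≤ a then g a q
    else if a ≤ q.1 ∧ Grid.pt i j ≤ (Grid.initRows m n).obj (Grid.pt a q.2) then e q else 0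
  have hpos : ∀ a q, i' ≤ a → g' a q = g a q := fun a q ha => if_pos ha
  have he : ∀ c l, ¬ i' ≤ c → e (Grid.pt c l) = 0 := fun c l hc => h₁ _ fun h => hc h.1
  have hmem : ((e, g') : HullSpace Z) ∈ hullSubmodule Z (Grid.pt i j) := by
    refine ⟨fun q hq => h₁ q fun h' => hq (h.trans h'), fun c l l' hl hc => ?_, fun a q ha => ?_,
      fun a q ha hq => ?_⟩
    · by_cases hc' : i' ≤ c
      · exact h₂ c l l' hl ⟨hc', hc.2⟩
      · change e _ = tr Z hl (e _)
        rw [he c l' hc', he c l hc', map_zero]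
    · by_cases ha' : i' ≤ a
      · exact (hpos a q ha').trans (h₃ a q fun h' => ha ⟨h.1.trans h'.1, h'.2⟩)
      · change g' a q = 0
        simp only [g', if_neg ha']
        exact if_neg fun h' => ha ⟨h'.2.1, h'.1⟩
    · by_cases ha' : i' ≤ a
      · exact (hpos a q ha').trans (h₄ a q ha ⟨ha', hq.2⟩)
      · change g' a q = e q - tr Z _ (e _)
        rw [he a q.2 ha', map_zero, sub_zero]
        simp only [g', if_neg ha']
        exact if_pos ⟨ha, hq⟩
  refine ⟨⟨(e, g'), hmem⟩, Subtype.ext (HullSpace.ext (fun q => ?_) fun a q => ?_)⟩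
  · change (hullTrunc Z (Grid.pt i' j) (e, g')).1 q = e q
    by_cases hq : Grid.pt i' j ≤ (Grid.initRows m n).obj q
    · exact hullTrunc_fst_of_le _ hq
    · exact (hullTrunc_fst_of_not_le _ hq).trans (h₁ q hq).symm
  · change (hullTrunc Z (Grid.pt i' j) (e, g')).2 a q = g a q
    by_cases ha : i' ≤ a
    · exact (hullTrunc_snd_of_le (p := Grid.pt i' j) _ q ha).trans (hpos a q ha)
    · exact (hullTrunc_snd_of_not_le (p := Grid.pt i' j) _ q ha).trans
        (h₃ a q fun h => ha h.1).symm

open Classical in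
/-- The compatible family generated by a vector in position `p`. -/
def hullFamily (p : Grid m n) : Z.obj p →ₗ[k] HullSpace Z :=
  LinearMap.prod (LinearMap.pi fun q => if h : p ≤ q then tr Z h else 0) 0

theorem hullFamily_fst_of_le {p q : Grid m n} (h : p ≤ q) (z : Z.obj p) :
    (hullFamily p z).1 q = tr Z h z := by
  classical
  change (if h : p ≤ q then tr Z h else 0 : Z.obj p →ₗ[k] Z.obj q) z = _
  rw [dif_pos h]

theorem hullFamily_fst_of_not_le {p q : Grid m n} (h : ¬ p ≤ q) (z : Z.obj p) :
    (hullFamily p z).1 q = 0 := by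
  classical
  change (if h : p ≤ q then tr Z h else 0 : Z.obj p →ₗ[k] Z.obj q) z = _
  rw [dif_neg h]
  rfl

theorem hullFamily_snd {p : Grid m n} (z : Z.obj p) (a : Fin m) (q : Grid m n) :
    (hullFamily p z).2 a q = 0 := rfl

theorem hullFamily_mem (p : Grid m n) (z : Z.obj p) :
    hullFamily p z ∈ hullSubmodule Z ((Grid.initRows m n).obj p) := by
  refine ⟨fun q hq => hullFamily_fst_of_not_le (p := p) hq z, fun c j j' h hc => ?_,
    fun a q _ => rfl, fun a q ha hq => ?_⟩
  · have hp : p ≤ Grid.pt c j := hc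
    rw [hullFamily_fst_of_le hp, hullFamily_fst_of_le (hp.trans h), tr_tr]
  · have hp : p ≤ Grid.pt a q.2 := hq
    rw [hullFamily_fst_of_le hp, hullFamily_fst_of_le (hp.trans (q.pt_fst_le ha)), tr_tr, sub_self]
    rfl

theorem hullTrunc_last_eq_zero_iff {p : Grid m n} {w : HullSpace Z}
    (hw : w ∈ hullSubmodule Z ((Grid.initRows m n).obj p)) :
    hullTrunc Z (Grid.pt p.1 (Fin.last n)) w = 0 ↔ ∀ a q, w.2 a q = 0 := by
  constructor
  · intro h a q
    by_cases ha : p.1 ≤ a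
    · rw [← hullTrunc_snd_of_le (p := Grid.pt p.1 (Fin.last n)) w q ha, h]
      rfl
    · exact hw.2.2.1 a q fun h => ha h.1
  · intro h
    refine HullSpace.ext (fun q => ?_) fun a q => ?_
    · refine hullTrunc_fst_of_not_le w fun hq => ?_
      exact absurd hq.2 (not_le.2 (Fin.castSucc_lt_last q.2))
    · by_cases ha : p.1 ≤ a
      · exact (hullTrunc_snd_of_le (p := Grid.pt p.1 (Fin.last n)) w q ha).trans (h a q)
      · exact hullTrunc_snd_of_not_le (p := Grid.pt p.1 (Fin.last n)) w q ha

theorem eq_hullFamily {p : Grid m n} {w : HullSpace Z}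
    (hw : w ∈ hullSubmodule Z ((Grid.initRows m n).obj p)) (h : ∀ a q, w.2 a q = 0) :
    hullFamily p (w.1 p) = w := by
  obtain ⟨h₁, h₂, -, h₄⟩ := hw
  refine HullSpace.ext (fun q => ?_) fun a q => (h a q).symm
  by_cases hq : p ≤ q
  · have hv : Grid.pt p.1 p.2 ≤ Grid.pt p.1 q.2 := ⟨le_rfl, hq.2⟩
    have e₁ : w.1 (Grid.pt p.1 q.2) = tr Z hv (w.1 p) := h₂ p.1 p.2 q.2 hv le_rfl
    have e₂ := h₄ p.1 q hq.1 hv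
    rw [h, e₁] at e₂
    rw [hullFamily_fst_of_le hq]
    exact ((sub_eq_zero.1 e₂.symm).trans (tr_tr hv (q.pt_fst_le hq.1) _)).symm
  · rw [hullFamily_fst_of_not_le hq, h₁ q hq]

variable (Z) in
/-- The identification of `Z` with the diagram of kernels of its horizontal hull. -/
def toKernelHull : Z ⟶ (kernelFunctor k m n).obj (horizHull Z) :=
  mkHom (fun p => ((hullFamily p).codRestrict (hullSubmodule Z ((Grid.initRows m n).obj p))
      (hullFamily_mem p)).codRestrict
        (LinearMap.ker (compAt (toLast (horizHull Z)) ((Grid.initRows m n).obj p))) fun z =>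
          Subtype.ext ((hullTrunc_last_eq_zero_iff (hullFamily_mem p z)).2 fun _ _ => rfl))
    fun p p' h z => by
      apply Subtype.ext
      apply Subtype.ext
      change hullFamily p' (tr Z h z) =
        hullTrunc Z ((Grid.initRows m n).obj p') (hullFamily p z)
      refine HullSpace.ext (fun q => ?_) fun a q => ?_
      · by_cases hq : p' ≤ q
        · rw [hullFamily_fst_of_le hq, hullTrunc_fst_of_le _ (Grid.initRows_le.2 hq),
            hullFamily_fst_of_le (h.trans hq), tr_tr]
        · rw [hullFamily_fst_of_not_le hq, hullTrunc_fst_of_not_le _ hq]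
      · rw [hullFamily_snd]
        exact (ite_self (0 : Z.obj q)).symm

variable (Z) in
theorem isIso_toKernelHull : IsIso (toKernelHull Z) := by
  refine isIso_of_compAt_bijective _ fun p => ⟨fun z z' h => ?_, fun w => ?_⟩
  · have e := congrArg (fun w => w.1.1.1 p) h
    change (hullFamily p z).1 p = (hullFamily p z').1 p at e
    rwa [hullFamily_fst_of_le le_rfl, hullFamily_fst_of_le le_rfl, tr_self, tr_self] at e
  · have h0 : hullTrunc Z (Grid.pt p.1 (Fin.last n)) w.1.1 = 0 := congrArg Subtype.val w.2
    exact ⟨w.1.1.1 p, Subtype.ext (Subtype.ext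
      (eq_hullFamily w.1.2 ((hullTrunc_last_eq_zero_iff w.1.2).1 h0)))⟩

end EssSurj

end

theorem mainTheorem2 (k : Type u) [Field k] (m n : ℕ) :
    (∃ H : ∀ (X Y : RepEStar k m (n + 1)) (f g : X ⟶ Y),
        factorRel (repEM k m (n + 1)) f g → (tFunctor k m n).map f = (tFunctor k m n).map g,
      (CategoryTheory.Quotient.lift (factorRel (repEM k m (n + 1))) (tFunctor k m n) H :
        AdditiveQuotient (repEM k m (n + 1)) ⥤ GridRep k m n).IsEquivalence) ∧
    (∀ X : GridRep k m (n + 1), horizEpiVertMono k m (n + 1) X ↔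
      ∃ (r : ℕ) (i : Fin r → Fin m) (j : Fin r → Fin (n + 1)),
        Nonempty (X ≅ ⨁ fun s : Fin r => thinRect k (i s) (j s))) := by
  refine ⟨⟨fun X Y f g => (factorRel_iff f g).1, ?_⟩, fun X => ⟨exists_iso_thinRect, ?_⟩⟩
  · refine { faithful := ⟨?_⟩, full := ⟨?_⟩, essSurj := ⟨fun Z => ?_⟩ }
    · rintro ⟨X⟩ ⟨Y⟩ ⟨f⟩ ⟨g⟩ h
      exact CategoryTheory.Quotient.sound _ ((factorRel_iff f g).2 h)
    · rintro ⟨X⟩ ⟨Y⟩ φ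
      obtain ⟨f, hf⟩ := exists_kernelFunctor_map_eq X.property Y.property φ
      exact ⟨(CategoryTheory.Quotient.functor _).map (ObjectProperty.homMk f), hf⟩
    · have := isIso_toKernelHull Z
      exact ⟨⟨⟨horizHull Z, horizEpi_horizHull Z⟩⟩, ⟨(asIso (toKernelHull Z)).symm⟩⟩
  · rintro ⟨r, i, j, ⟨e⟩⟩
    obtain ⟨π, σ, h⟩ := exists_sum_eq_id_of_iso e
    exact horizEpiVertMono_of_sum (fun s => horizEpiVertMono_thinRect (i s) (j s)) π σ h
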